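/- Consider a two-tier cellular network in the plane $\mathbb{R}^2$ with a user at the origin. For $j\in\{1,2\}$ (macro tier $j=1$, helper tier $j=2$), the stations of tier $j$ form a homogeneous Poisson point process $\Phi_j=\{x_{j,i}\}_i$ of density $\lambda_j>0$; every station is active with probability $p_{{\rm a},j}\in[0,1]$, independently of everything else (so that the active stations $\tilde\Phi_j$ form a Poisson process of density $p_{{\rm a},j}\lambda_j$); the transmit power is $P_j>0$, the path-loss exponent is $\alpha_j>2$, the number of antennas is the integer $M_j\ge 1$; and the interference channel gains $h_{j,i}$ are i.i.d. gamma variables with shape $M_j$ and scale $1/M_j$, independent of the locations and of the activities. The two tiers are independent. A cache-miss user can only be served by the macro tier: it is served by the station $b_{1,0}$ of $\Phi_1$ closest to the origin, at distance $r_1=\min_i\|x_{1,i}\|$. Let $$I_{1,1}=\sum_{i\in\tilde\Phi_1\setminus b_{1,0}}P_1h_{1,i}\|x_{1,i}\|^{-\alpha_1},\qquad I_{1,2}=\sum_{i\in\tilde\Phi_2}P_2h_{2,i}\|x_{2,i}\|^{-\alpha_2}$$ be the interference from the macro and the helper tier. Both sums converge almost surely, and for every real $s\ge 0$ their Laplace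 transforms conditional on the serving distance are, for almost every value $r$ of $r_1$, $$\mathbb{E}\big[e^{-sI_{1,1}}\,\big|\,r_1=r\big]=\exp\Big(-\pi p_{{\rm a},1}\lambda_1r^2\Big({}_2F_1\Big[-\tfrac{2}{\alpha_1},M_1;1-\tfrac{2}{\alpha_1};-\tfrac{sP_1}{M_1}r^{-\alpha_1}\Big]-1\Big)\Big),$$ $$\mathbb{E}\big[e^{-sI_{1,2}}\,\big|\,r_1=r\big]=\mathbb{E}\big[e^{-sI_{1,2}}\big]=\exp\Big(-\pi p_{{\rm a},2}\lambda_2\frac{\Gamma(1-\frac{2}{\alpha_2})\,\Gamma(M_2+\frac{2}{\alpha_2})}{\Gamma(M_2)}\Big(\frac{sP_2}{M_2}\Big)^{2/\alpha_2}\Big).$$ Here ${}_2F_1$ is the Gauss hypergeometric function, i.e. the analytic continuation of the hypergeometric series to $\mathbb{C}\setminus[1,\infty)$. Moreover, the right-hand side for the helper tier is the limit, as $r_0\to 0^+$, of $$\exp\Big(-\pi p_{{\rm a},2}\lambda_2r_0^2\Big({}_2F_1\Big[-\tfrac{2}{\alpha_2},M_2;1-\tfrac{2}{\alpha_2};-\tfrac{sP_2}{M_2}r_0^{-\alpha_2}\Big]-1\Big)\Big).$$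 -/

import Mathlib

open MeasureTheory ProbabilityTheory Filter Topology

/-- The plane, in which base stations are placed; the typical user sits at the origin. -/
abbrev Plane : Type := EuclideanSpace ℝ (Fin 2)

section PointProcess

variable {Ω : Type*} [MeasurableSpace Ω]

/-- The random counting measure `∑ i, δ_{X i}` of a sequence of random points of the plane. -/
noncomputable def pointMeasure (X : ℕ → Ω → Plane) (ω : Ω) : Measure Plane :=
  Measure.sum fun i => Measure.dirac (X i ω)

/-- The random points `X 0, X 1, …` enumerate a homogeneous Poisson point process of density
`lam > 0` in the plane: the number of points in a Borel set of finite area is Poisson distributed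
with mean `lam` times the area, and the numbers of points in pairwise disjoint sets are
independent. (As `lam > 0`, such a process almost surely has infinitely many points.) -/
structure IsHomogeneousPPP (μ : Measure Ω) (lam : ℝ) (X : ℕ → Ω → Plane) : Prop where
  measurable : ∀ i, Measurable (X i)
  count_law : ∀ B : Set Plane, MeasurableSet B → volume B < ⊤ → ∀ n : ℕ,
    μ {ω | pointMeasure X ω B = n} = poissonMeasure (lam * (volume B).toReal).toNNReal {n}
  indep_counts : ∀ (m : ℕ) (B : Fin m → Set Plane), (∀ l, MeasurableSet (B l)) →
    (∀ l, volume (B l) < ⊤) → Pairwise (fun l l' => Disjoint (B l) (B l')) →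
    iIndepFun (fun l ω => pointMeasure X ω (B l)) μ

/-- A tier of base stations: the locations `X i` form a homogeneous Poisson point process of
density `lam`; each station is active (`A i = true`) with probability `pa`, independently of
everything else (independent thinning); the interference channel gains `H i` are gamma distributed
with shape `M` and scale `1 / M` (rate `M`), hence of unit mean, and independent of everything
else. -/
structure IsTier (μ : Measure Ω) (lam pa : ℝ) (M : ℕ)
    (X : ℕ → Ω → Plane) (A : ℕ → Ω → Bool) (H : ℕ → Ω → ℝ) : Prop where
  ppp : IsHomogeneousPPP μ lam X
  measurable_active : ∀ i, Measurable (A i)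
  measurable_fading : ∀ i, Measurable (H i)
  active_law : ∀ i, μ {ω | A i ω = true} = ENNReal.ofReal pa
  fading_law : ∀ i, μ.map (H i) = gammaMeasure M M
  indep_active_fading : ∀ i, IndepFun (A i) (H i) μ
  indep_marks : iIndepFun (fun i ω => (A i ω, H i ω)) μ
  indep_locations_marks : IndepFun (fun ω i => X i ω) (fun ω i => (A i ω, H i ω)) μ

/-- The index of the station closest to the origin (the smallest one, in the null event of a tie).
This is the serving station of a user that can only be served by the tier `X`. -/
noncomputable def servingIndex (X : ℕ → Ω → Plane) (ω : Ω) : ℕ :=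
  sInf {n | ∀ i, ‖X n ω‖ ≤ ‖X i ω‖}

/-- The distance from the user at the origin to its serving station. -/
noncomputable def servingDistance (X : ℕ → Ω → Plane) (ω : Ω) : ℝ :=
  ‖X (servingIndex X ω) ω‖

/-- The power received at the origin from the `i`-th station, of transmit power `P` and path loss
exponent `α`, if that station is active, and `0` if it is idle. -/
noncomputable def receivedPower (P α : ℝ) (X : ℕ → Ω → Plane) (A : ℕ → Ω → Bool)
    (H : ℕ → Ω → ℝ) (ω : Ω) (i : ℕ) : ℝ :=
  if A i ω = true then P * H i ω * ‖X i ω‖ ^ (-α) else 0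

/-- The same, with the serving (closest) station of the tier left out. -/
noncomputable def receivedPowerNonServing (P α : ℝ) (X : ℕ → Ω → Plane) (A : ℕ → Ω → Bool)
    (H : ℕ → Ω → ℝ) (ω : Ω) (i : ℕ) : ℝ :=
  if i = servingIndex X ω then 0 else receivedPower P α X A H ω i

/-- Interference from the serving tier: all active stations other than the serving one. -/
noncomputable def servingTierInterference (P α : ℝ) (X : ℕ → Ω → Plane) (A : ℕ → Ω → Bool)
    (H : ℕ → Ω → ℝ) (ω : Ω) : ℝ :=
  ∑' i, receivedPowerNonServing P α X A H ω i

/-- Interference from a tier that does not serve the user: all active stations. -/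
noncomputable def otherTierInterference (P α : ℝ) (X : ℕ → Ω → Plane) (A : ℕ → Ω → Bool)
    (H : ℕ → Ω → ℝ) (ω : Ω) : ℝ :=
  ∑' i, receivedPower P α X A H ω i

end PointProcess

section Hypergeometric

/-- `F` is an analytic continuation of the Gauss hypergeometric series with parameters `a, b; c`
from the unit disc to the plane cut along `[1, ∞)`. By the identity theorem there is at most one
such function on the cut plane. -/
def IsGaussContinuation (a b c : ℂ) (F : ℂ → ℂ) : Prop :=
  AnalyticOnNhd ℂ F {z : ℂ | 1 - z ∈ Complex.slitPlane} ∧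
    ∀ z : ℂ, ‖z‖ < 1 → F z = ordinaryHypergeometric a b c z

open Classical in
/-- The Gauss hypergeometric function (principal branch) on the plane cut along `[1, ∞)`.
Mathlib's `ordinaryHypergeometric` is only the power series, with value `0` where the series
diverges. -/
noncomputable def gaussHypergeometricC (a b c z : ℂ) : ℂ :=
  if h : ∃ F : ℂ → ℂ, IsGaussContinuation a b c F then h.choose z else 0

/-- The Gauss hypergeometric function `₂F₁[a, b; c; x]` for real parameters and real `x < 1`, where
the principal branch is real. -/
noncomputable def gaussHypergeometric (a b c x : ℝ) : ℝ :=
  (gaussHypergeometricC a b c x).re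

end Hypergeometric

/-- The Laplace transform at `s` of the interference from a tier of active density `pa * lam` with
exclusion radius `r`:
`exp (-π pa lam r² (₂F₁[-2/α, M; 1 - 2/α; -(s P / M) r^(-α)] - 1))`. -/
noncomputable def exclusionLaplace (lam pa P α : ℝ) (M : ℕ) (s r : ℝ) : ℝ :=
  Real.exp (-(Real.pi * pa * lam * r ^ 2 *
    (gaussHypergeometric (-(2 / α)) M (1 - 2 / α) (-(s * P / M) * r ^ (-α)) - 1)))

/-- `exp (-π pa lam Γ(1 - 2/α) Γ(M + 2/α) / Γ(M) (s P / M)^(2/α))`. -/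
noncomputable def noExclusionLaplace (lam pa P α : ℝ) (M : ℕ) (s : ℝ) : ℝ :=
  Real.exp (-(Real.pi * pa * lam *
    (Real.Gamma (1 - 2 / α) * Real.Gamma (M + 2 / α) / Real.Gamma M) *
      (s * P / M) ^ (2 / α)))

/-! The Laplace variable `exp (-s ∑ Zᵢ)` of an interference sum is the product of `exp (-s Zᵢ)` over
the stations. Given the locations, the factors are independent, and averaging over activity and
gamma fading turns the factor of a station at `x` into `1 - ψ x`, where `ψ x = pa (1 - (1 + s P
‖x‖^(-α) / M)^(-M))` is `stationLoss`. The Laplace functional of the Poisson process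
(`IsHomogeneousPPP.integral_infProd`) then yields `exp (-lam ∫ ψ)`, which is the helper-tier
formula.

For the serving tier, the stations beyond the nearest one, at distance `r`, should form a Poisson
process outside the disc of radius `r`, so that `ψ` is integrated over `‖x‖ > r` only. This is
proved without Palm theory. For fixed `u ≤ t`, the event `u ≤ r₁` says that a disc is empty, and the
Laplace functional factors it from the points beyond `t`. Subtracting two such identities handles `u
≤ r₁ < t` with exclusion radius `t`, and a grid of mesh tending to zero moves the exclusion radius
to `r₁` itself (`IsHomogeneousPPP.setIntegral_infProd_nonServing`).

The substitution `v = ‖x‖^(-α)` makes both integrals explicit. Over the whole plane it gives a sum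
of beta integrals that telescopes to the Gamma quotient. Outside a disc it gives an Euler integral
with its divergent part subtracted. That integral is analytic on the cut plane and agrees with the
hypergeometric series on the unit disc, hence is its continuation (`gaussHypergeometric_sub_one`).

Almost sure convergence of the sums comes from the same computation: a divergent sum makes the
product vanish for every `s > 0`, while its mean tends to `1` as `s → 0`. The limit of vanishing
exclusion radius is dominated convergence. -/

/-! ### Infinite products of factors in the unit interval -/

section InfiniteProduct

/-- The infinite product of a sequence in `[0, 1]`, as the infimum of its partial products. -/
noncomputable def infProd (a : ℕ → ℝ) : ℝ := ⨅ n, ∏ i ∈ Finset.range n, a i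

variable {a b : ℕ → ℝ}

lemma bddBelow_partialProd (ha : ∀ i, a i ∈ Set.Icc (0 : ℝ) 1) :
    BddBelow (Set.range fun n => ∏ i ∈ Finset.range n, a i) :=
  ⟨0, by rintro _ ⟨n, rfl⟩; exact Finset.prod_nonneg fun i _ => (ha i).1⟩

lemma antitone_partialProd (ha : ∀ i, a i ∈ Set.Icc (0 : ℝ) 1) :
    Antitone fun n => ∏ i ∈ Finset.range n, a i :=
  antitone_nat_of_succ_le fun n => by
    rw [Finset.prod_range_succ]
    exact mul_le_of_le_one_right (Finset.prod_nonneg fun i _ => (ha i).1) (ha n).2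

lemma tendsto_partialProd (ha : ∀ i, a i ∈ Set.Icc (0 : ℝ) 1) :
    Tendsto (fun n => ∏ i ∈ Finset.range n, a i) atTop (𝓝 (infProd a)) :=
  tendsto_atTop_ciInf (antitone_partialProd ha) (bddBelow_partialProd ha)

lemma infProd_le (ha : ∀ i, a i ∈ Set.Icc (0 : ℝ) 1) (n : ℕ) :
    infProd a ≤ ∏ i ∈ Finset.range n, a i :=
  ciInf_le (bddBelow_partialProd ha) n

lemma infProd_nonneg (ha : ∀ i, a i ∈ Set.Icc (0 : ℝ) 1) : 0 ≤ infProd a :=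
  le_ciInf fun _ => Finset.prod_nonneg fun i _ => (ha i).1

lemma infProd_le_one (ha : ∀ i, a i ∈ Set.Icc (0 : ℝ) 1) : infProd a ≤ 1 := by
  simpa using infProd_le ha 0

lemma infProd_mono (ha : ∀ i, a i ∈ Set.Icc (0 : ℝ) 1) (hab : ∀ i, a i ≤ b i) :
    infProd a ≤ infProd b :=
  ciInf_mono (bddBelow_partialProd ha) fun _ =>
    Finset.prod_le_prod (fun i _ => (ha i).1) fun i _ => hab i

/-- An infimum of continuous functions is only upper semicontinuous, which gives the upper bound
through a single partial product. The lower bound needs the approximation from above, `hau`;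
otherwise small factors could escape to ever larger indices. -/
lemma tendsto_infProd {u : ℕ → ℕ → ℝ} (ha : ∀ i, a i ∈ Set.Icc (0 : ℝ) 1)
    (hu : ∀ k i, u k i ∈ Set.Icc (0 : ℝ) 1) (hau : ∀ k i, a i ≤ u k i)
    (hlim : ∀ i, Tendsto (fun k => u k i) atTop (𝓝 (a i))) :
    Tendsto (fun k => infProd (u k)) atTop (𝓝 (infProd a)) := by
  refine tendsto_order.2 ⟨fun c hc => ?_, fun c hc => ?_⟩
  · exact Eventually.of_forall fun k => hc.trans_le (infProd_mono ha (hau k))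
  · obtain ⟨n, hn⟩ := exists_lt_of_ciInf_lt hc
    have := tendsto_finsetProd (Finset.range n) fun i _ => hlim i
    filter_upwards [this.eventually (gt_mem_nhds hn)] with k hk
    exact (infProd_le (hu k) n).trans_lt hk

lemma infProd_eq_prod (ha : ∀ i, a i ∈ Set.Icc (0 : ℝ) 1) (S : Finset ℕ)
    (hS : ∀ i ∉ S, a i = 1) : infProd a = ∏ i ∈ S, a i := by
  refine tendsto_nhds_unique (tendsto_partialProd ha) (tendsto_atTop_of_eventually_const
    (i₀ := S.sup id + 1) fun n hn => ?_)
  refine (Finset.prod_subset (fun i hi => ?_) fun i _ hi => hS i hi).symm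
  have : i ≤ S.sup id := Finset.le_sup (f := id) hi
  simp; omega

lemma measurable_infProd {β : Type*} [MeasurableSpace β] {u : ℕ → β → ℝ}
    (hu : ∀ i, Measurable (u i)) : Measurable fun x => infProd fun i => u i x :=
  Measurable.iInf fun _ => Finset.measurable_prod _ fun i _ => hu i

lemma exp_neg_mem_Icc {x : ℝ} (hx : 0 ≤ x) : Real.exp (-x) ∈ Set.Icc (0 : ℝ) 1 :=
  ⟨(Real.exp_pos _).le, by simpa using hx⟩

lemma infProd_exp_of_summable (ha : ∀ i, 0 ≤ a i) (h : Summable a) :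
    infProd (fun i => Real.exp (-a i)) = Real.exp (-∑' i, a i) := by
  refine tendsto_nhds_unique (tendsto_partialProd fun i => exp_neg_mem_Icc (ha i)) ?_
  simp_rw [← Real.exp_sum, Finset.sum_neg_distrib]
  exact (Real.continuous_exp.tendsto _).comp h.hasSum.tendsto_sum_nat.neg

/-- Here `tsum` would default to `0` and its exponential to `1`. The product takes the correct value
`0` instead, and this is how divergence of the interference is detected later. -/
lemma infProd_exp_of_not_summable (ha : ∀ i, 0 ≤ a i) (h : ¬ Summable a) :
    infProd (fun i => Real.exp (-a i)) = 0 := by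
  refine tendsto_nhds_unique (tendsto_partialProd fun i => exp_neg_mem_Icc (ha i)) ?_
  simp_rw [← Real.exp_sum, Finset.sum_neg_distrib]
  exact Real.tendsto_exp_neg_atTop_nhds_zero.comp
    ((not_summable_iff_tendsto_nat_atTop_of_nonneg ha).1 h)

end InfiniteProduct

/-! ### Counting the points in a Borel set -/

section Counting

variable {Ω : Type*}

lemma pointMeasure_eq_count (X : ℕ → Ω → Plane) (ω : Ω) {B : Set Plane} (hB : MeasurableSet B) :
    pointMeasure X ω B = Measure.count {i | X i ω ∈ B} := by
  rw [pointMeasure, Measure.sum_apply _ hB, Measure.count_apply MeasurableSet.of_discrete,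
    ← ENNReal.tsum_set_one, tsum_subtype {i | X i ω ∈ B} (fun _ => (1 : ENNReal))]
  simp only [Measure.dirac_apply' _ hB]
  rfl

lemma finite_of_pointMeasure_lt_top {X : ℕ → Ω → Plane} {ω : Ω} {B : Set Plane}
    (hB : MeasurableSet B) (h : pointMeasure X ω B < ⊤) : {i | X i ω ∈ B}.Finite := by
  rw [pointMeasure_eq_count X ω hB] at h
  exact Measure.count_apply_lt_top.1 h

lemma pointMeasure_eq_card {X : ℕ → Ω → Plane} {ω : Ω} {B : Set Plane}
    (hB : MeasurableSet B) (S : Finset ℕ) (hS : ∀ i, i ∈ S ↔ X i ω ∈ B) :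
    pointMeasure X ω B = S.card := by
  rw [pointMeasure_eq_count X ω hB, ← Measure.count_apply_finset]
  congr 1; ext i; simp [hS]

lemma measurable_pointMeasure [MeasurableSpace Ω] {X : ℕ → Ω → Plane} (hX : ∀ i, Measurable (X i)) {B : Set Plane}
    (hB : MeasurableSet B) : Measurable fun ω => pointMeasure X ω B := by
  simp only [pointMeasure, Measure.sum_apply _ hB, Measure.dirac_apply' _ hB]
  exact Measurable.tsum fun i => (measurable_one.indicator hB).comp (hX i)

end Counting

/-! ### The Laplace functional of a Poisson process -/

section PoissonProcess

variable {Ω : Type*} [MeasurableSpace Ω] {μ : Measure Ω} [IsProbabilityMeasure μ] {lam : ℝ}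
  {X : ℕ → Ω → Plane}

lemma IsHomogeneousPPP.map_count (h : IsHomogeneousPPP μ lam X) {B : Set Plane}
    (hB : MeasurableSet B) (hfin : volume B < ⊤) :
    μ.map (fun ω => pointMeasure X ω B) =
      (poissonMeasure (lam * (volume B).toReal).toNNReal).map (fun n : ℕ => (n : ENNReal)) := by
  have hm := measurable_pointMeasure h.measurable hB
  have hc : Measurable fun n : ℕ => (n : ENNReal) := measurable_from_top
  have := Measure.isProbabilityMeasure_map (μ := μ) hm.aemeasurable
  have := Measure.isProbabilityMeasure_map
    (μ := poissonMeasure (lam * (volume B).toReal).toNNReal) hc.aemeasurable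
  symm
  -- Only the masses at finite integers are prescribed. Since they already add up to one, an
  -- inequality between the two probability measures suffices, and the value `⊤` is excluded as a
  -- by-product.
  refine Measure.eq_of_le_of_isProbabilityMeasure (Measure.le_iff.2 fun s hs => ?_)
  rw [Measure.map_apply hc hs, Measure.map_apply hm hs]
  set T := (fun n : ℕ => (n : ENNReal)) ⁻¹' s
  calc poissonMeasure (lam * (volume B).toReal).toNNReal T
      = ∑' n : T, poissonMeasure (lam * (volume B).toReal).toNNReal {(n : ℕ)} := by
        rw [← measure_biUnion T.to_countable (fun i _ j _ hij => by simpa using hij)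
          (fun i _ => MeasurableSet.of_discrete), Set.biUnion_of_singleton]
    _ = ∑' n : T, μ {ω | pointMeasure X ω B = (n : ℕ)} := by
        simp_rw [h.count_law B hB hfin]
    _ = μ (⋃ n ∈ T, {ω | pointMeasure X ω B = (n : ℕ)}) := by
        rw [measure_biUnion T.to_countable]
        · intro i _ j _ hij
          refine Set.disjoint_left.2 fun ω hi hj => hij ?_
          exact_mod_cast (show pointMeasure X ω B = i from hi).symm.trans hj
        · exact fun n _ => hm (measurableSet_singleton _)
    _ ≤ _ := by
        refine measure_mono fun ω hω => ?_
        simp only [Set.mem_iUnion] at hω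
        obtain ⟨n, hn, hω⟩ := hω
        have hω : pointMeasure X ω B = n := hω
        rw [Set.mem_preimage, hω]; exact hn

lemma IsHomogeneousPPP.ae_count_lt_top (h : IsHomogeneousPPP μ lam X) {B : Set Plane}
    (hB : MeasurableSet B) (hfin : volume B < ⊤) : ∀ᵐ ω ∂μ, pointMeasure X ω B < ⊤ := by
  have hm := measurable_pointMeasure h.measurable hB
  have hc : Measurable fun n : ℕ => (n : ENNReal) := measurable_from_top
  have : ∀ᵐ x ∂(μ.map (fun ω => pointMeasure X ω B)), x < ⊤ := by
    rw [h.map_count hB hfin, ae_map_iff hc.aemeasurable measurableSet_Iio]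
    exact Eventually.of_forall fun n => ENNReal.natCast_lt_top n
  exact (ae_map_iff hm.aemeasurable measurableSet_Iio).1 this

lemma IsHomogeneousPPP.integral_rpow_count (h : IsHomogeneousPPP μ lam X) (hlam : 0 < lam)
    {B : Set Plane} (hB : MeasurableSet B) (hfin : volume B < ⊤) (v : ℝ) :
    ∫ ω, v ^ (pointMeasure X ω B).toReal ∂μ = Real.exp (-(lam * (volume.real B * (1 - v)))) := by
  have hm := measurable_pointMeasure h.measurable hB
  have hc : Measurable fun n : ℕ => (n : ENNReal) := measurable_from_top
  have hg : Measurable fun x : ENNReal => v ^ x.toReal := by fun_prop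
  have hr : ((lam * (volume B).toReal).toNNReal : ℝ) = lam * volume.real B :=
    Real.coe_toNNReal _ (by positivity)
  rw [← integral_map (φ := fun ω => pointMeasure X ω B) (f := fun x : ENNReal => v ^ x.toReal)
    hm.aemeasurable hg.aestronglyMeasurable, h.map_count hB hfin,
    integral_map hc.aemeasurable hg.aestronglyMeasurable, integral_poissonMeasure]
  simp only [ENNReal.toReal_natCast, Real.rpow_natCast, smul_eq_mul, hr]
  have : ∀ n : ℕ, Real.exp (-(lam * volume.real B)) * (lam * volume.real B) ^ n / n.factorial
      * v ^ n = Real.exp (-(lam * volume.real B)) *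
        ((lam * volume.real B * v) ^ n / n.factorial) := fun n => by rw [mul_pow _ v]; ring
  simp_rw [this]
  rw [tsum_mul_left, (NormedSpace.expSeries_div_hasSum_exp (lam * volume.real B * v)).tsum_eq,
    ← Real.exp_eq_exp_ℝ, ← Real.exp_add]
  congr 1; ring

omit [IsProbabilityMeasure μ] in
lemma IsHomogeneousPPP.iIndepFun_count (h : IsHomogeneousPPP μ lam X) {ι : Type*} [Fintype ι]
    (B : ι → Set Plane) (hB : ∀ l, MeasurableSet (B l)) (hfin : ∀ l, volume (B l) < ⊤)
    (hd : Pairwise fun l l' => Disjoint (B l) (B l')) :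
    iIndepFun (fun l ω => pointMeasure X ω (B l)) μ := by
  let e := Fintype.equivFin ι
  have := (h.indep_counts _ (fun l => B (e.symm l)) (fun l => hB _) (fun l => hfin _)
    (fun l l' hl => hd (e.symm.injective.ne hl))).precomp e.injective
  simpa using this

/-- The Laplace functional of a Poisson process on simple functions. -/
lemma IsHomogeneousPPP.integral_infProd_simpleFunc (h : IsHomogeneousPPP μ lam X) (hlam : 0 < lam)
    (ψ : SimpleFunc Plane ℝ) (hψ : ∀ x, ψ x ∈ Set.Icc (0 : ℝ) 1) (hint : Integrable ψ volume) :
    ∫ ω, infProd (fun i => 1 - ψ (X i ω)) ∂μ = Real.exp (-(lam * ∫ x, ψ x)) := by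
  classical
  -- The level sets of nonzero values have finite area by integrability. The zero level set may have
  -- infinite area, but its points only contribute factors `1`.
  set V : Finset ℝ := {v ∈ ψ.range | v ≠ 0} with hV
  have hfin : ∀ v : V, volume (ψ ⁻¹' {(v : ℝ)}) < ⊤ := fun v =>
    (SimpleFunc.integrable_iff_finMeasSupp.1 hint).meas_preimage_singleton_ne_zero
      (Finset.mem_filter.1 v.2).2
  have hmeas : ∀ v : V, MeasurableSet (ψ ⁻¹' {(v : ℝ)}) := fun v => ψ.measurableSet_fiber _
  have hind := h.iIndepFun_count (fun v : V => ψ ⁻¹' {(v : ℝ)}) hmeas hfin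
    (fun v w hvw => Set.disjoint_left.2 fun x hx hx' => hvw (Subtype.ext (by
      simp only [Set.mem_preimage, Set.mem_singleton_iff] at hx hx'; rw [← hx, ← hx'])))
  -- Grouping the points by the value of `ψ` leaves a finite product of powers of independent
  -- Poisson counts.
  have key : (fun ω => infProd (fun i => 1 - ψ (X i ω))) =ᵐ[μ]
      fun ω => ∏ v : V, (1 - (v : ℝ)) ^ (pointMeasure X ω (ψ ⁻¹' {(v : ℝ)})).toReal := by
    filter_upwards [ae_all_iff.2 fun v => h.ae_count_lt_top (hmeas v) (hfin v)] with ω hω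
    have hSfin := fun v : V => finite_of_pointMeasure_lt_top (hmeas v) (hω v)
    let S : V → Finset ℕ := fun v => (hSfin v).toFinset
    have hS : ∀ v i, i ∈ S v ↔ X i ω ∈ ψ ⁻¹' {(v : ℝ)} := fun v i => by simp [S]
    have hd : (↑(Finset.univ : Finset V) : Set V).PairwiseDisjoint S := by
      intro v _ w _ hvw
      refine Finset.disjoint_left.2 fun i hi hi' => hvw (Subtype.ext ?_)
      rw [hS] at hi hi'
      exact (Set.mem_singleton_iff.1 hi).symm.trans hi'
    rw [infProd_eq_prod (fun i => ⟨by linarith [(hψ (X i ω)).2], by linarith [(hψ (X i ω)).1]⟩)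
      (Finset.univ.biUnion S), Finset.prod_biUnion hd]
    · refine Finset.prod_congr rfl fun v _ => ?_
      rw [pointMeasure_eq_card (hmeas v) (S v) (hS v), ENNReal.toReal_natCast, Real.rpow_natCast,
        ← Finset.prod_const]
      refine Finset.prod_congr rfl fun i hi => ?_
      rw [hS] at hi
      rw [Set.mem_singleton_iff.1 hi]
    · intro i hi
      by_contra hne
      refine hi (Finset.mem_biUnion.2 ⟨⟨ψ (X i ω), Finset.mem_filter.2
        ⟨ψ.mem_range_self _, fun h0 => hne (by simp [h0])⟩⟩, Finset.mem_univ _, ?_⟩)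
      rw [hS]; simp
  have hcm : ∀ v : V, Measurable fun ω => pointMeasure X ω (ψ ⁻¹' {(v : ℝ)}) := fun v =>
    measurable_pointMeasure h.measurable (hmeas v)
  rw [integral_congr_ae key, hind.integral_fun_prod_comp (f := fun (v : V) (x : ENNReal) => (1 - (v : ℝ)) ^ x.toReal)
    (fun v => (hcm v).aemeasurable)
    (fun v => (Measurable.pow measurable_const ENNReal.measurable_toReal).aestronglyMeasurable)]
  rw [← SimpleFunc.integral_eq_integral _ hint, SimpleFunc.integral_eq_sum_filter, ← hV,
    ← Finset.sum_coe_sort V, Finset.mul_sum, ← Finset.sum_neg_distrib, Real.exp_sum]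
  refine Finset.prod_congr rfl fun v _ => ?_
  rw [h.integral_rpow_count hlam (hmeas v) (hfin v)]
  simp

/-- The Laplace functional of a Poisson process. -/
lemma IsHomogeneousPPP.integral_infProd (h : IsHomogeneousPPP μ lam X) (hlam : 0 < lam)
    {ψ : Plane → ℝ} (hm : Measurable ψ) (hψ : ∀ x, ψ x ∈ Set.Icc (0 : ℝ) 1)
    (hint : Integrable ψ volume) :
    ∫ ω, infProd (fun i => 1 - ψ (X i ω)) ∂μ = Real.exp (-(lam * ∫ x, ψ x)) := by
  have hm' : Measurable fun x => ENNReal.ofReal (ψ x) := hm.ennreal_ofReal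
  -- Approximation of `ψ` from below, so that the factors `1 - S k` lie above `1 - ψ`, as
  -- `tendsto_infProd` requires.
  let S : ℕ → SimpleFunc Plane ℝ := fun k =>
    (SimpleFunc.eapprox (fun x => ENNReal.ofReal (ψ x)) k).map ENNReal.toReal
  have hSle : ∀ k x, S k x ≤ ψ x := fun k x => by
    have h1 : SimpleFunc.eapprox (fun x => ENNReal.ofReal (ψ x)) k x ≤ ENNReal.ofReal (ψ x) := by
      conv_rhs => rw [← SimpleFunc.iSup_eapprox_apply hm' x]
      exact le_iSup (fun n => SimpleFunc.eapprox (fun x => ENNReal.ofReal (ψ x)) n x) k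
    calc S k x ≤ (ENNReal.ofReal (ψ x)).toReal := ENNReal.toReal_mono (by simp) h1
      _ = ψ x := ENNReal.toReal_ofReal (hψ x).1
  have hS0 : ∀ k x, 0 ≤ S k x := fun k x => ENNReal.toReal_nonneg
  have hSlim : ∀ x, Tendsto (fun k => S k x) atTop (𝓝 (ψ x)) := fun x => by
    have := (ENNReal.tendsto_toReal (a := ENNReal.ofReal (ψ x)) (by simp)).comp
      (SimpleFunc.tendsto_eapprox hm' x)
    rwa [ENNReal.toReal_ofReal (hψ x).1] at this
  have hSint : ∀ k, Integrable (S k) volume := fun k =>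
    hint.mono' (S k).measurable.aestronglyMeasurable (Eventually.of_forall fun x => by
      rw [Real.norm_of_nonneg (hS0 k x)]; exact hSle k x)
  have hSI : ∀ k x, S k x ∈ Set.Icc (0 : ℝ) 1 := fun k x => ⟨hS0 k x, (hSle k x).trans (hψ x).2⟩
  have hI : ∀ y : ℝ, y ∈ Set.Icc (0 : ℝ) 1 → 1 - y ∈ Set.Icc (0 : ℝ) 1 := fun y hy =>
    ⟨by linarith [hy.2], by linarith [hy.1]⟩
  have lhs : Tendsto (fun k => ∫ ω, infProd (fun i => 1 - S k (X i ω)) ∂μ) atTop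
      (𝓝 (∫ ω, infProd (fun i => 1 - ψ (X i ω)) ∂μ)) := by
    refine tendsto_integral_of_dominated_convergence (fun _ => 1) (fun k => ?_)
      (integrable_const _) (fun k => Eventually.of_forall fun ω => ?_)
      (Eventually.of_forall fun ω => ?_)
    · exact (measurable_infProd fun i => measurable_const.sub
        ((S k).measurable.comp (h.measurable i))).aestronglyMeasurable
    · rw [Real.norm_of_nonneg (infProd_nonneg fun i => hI _ (hSI k _))]
      exact infProd_le_one fun i => hI _ (hSI k _)
    · exact tendsto_infProd (fun i => hI _ (hψ _)) (fun k i => hI _ (hSI k _))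
        (fun k i => by linarith [hSle k (X i ω)]) (fun i => (hSlim _).const_sub 1)
  have rhs : Tendsto (fun k => Real.exp (-(lam * ∫ x, S k x))) atTop
      (𝓝 (Real.exp (-(lam * ∫ x, ψ x)))) := by
    refine (Real.continuous_exp.tendsto _).comp (Tendsto.neg (Tendsto.const_mul _ ?_))
    exact tendsto_integral_of_dominated_convergence ψ
      (fun k => (S k).measurable.aestronglyMeasurable) hint
      (fun k => Eventually.of_forall fun x => by
        rw [Real.norm_of_nonneg (hS0 k x)]; exact hSle k x)
      (Eventually.of_forall hSlim)
  refine tendsto_nhds_unique lhs (rhs.congr fun k => ?_)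
  exact (h.integral_infProd_simpleFunc hlam (S k) (hSI k) (hSint k)).symm

end PoissonProcess

/-! ### The nearest station: existence and measurability -/

section Nearest

variable {Ω : Type*}

/-- Local finiteness makes the minimum attained, since only the finitely many points within `‖X 0 ω‖
+ 1` compete. Without a minimiser `servingIndex` would be the default `sInf ∅ = 0`. -/
lemma servingDistance_le {X : ℕ → Ω → Plane} {ω : Ω}
    (hfin : ∀ R : ℝ, {i | ‖X i ω‖ < R}.Finite) (i : ℕ) : servingDistance X ω ≤ ‖X i ω‖ := by
  obtain ⟨n, -, hn⟩ := (hfin (‖X 0 ω‖ + 1)).toFinset.exists_min_image (fun i => ‖X i ω‖)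
    ⟨0, by simp⟩
  have hne : {n | ∀ i, ‖X n ω‖ ≤ ‖X i ω‖}.Nonempty := by
    refine ⟨n, fun j => ?_⟩
    by_cases hj : ‖X j ω‖ < ‖X 0 ω‖ + 1
    · exact hn j (by simpa using hj)
    · have := hn 0 (by simp)
      linarith
  exact Nat.sInf_mem hne i

lemma le_servingDistance_iff {X : ℕ → Ω → Plane} {ω : Ω}
    (hfin : ∀ R : ℝ, {i | ‖X i ω‖ < R}.Finite) {u : ℝ} :
    u ≤ servingDistance X ω ↔ ∀ i, u ≤ ‖X i ω‖ :=
  ⟨fun h i => h.trans (servingDistance_le hfin i), fun h => h _⟩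

variable [MeasurableSpace Ω]

lemma measurable_servingIndex {X : ℕ → Ω → Plane} (hX : ∀ i, Measurable (X i)) :
    Measurable (servingIndex X) := by
  have hS : ∀ n, MeasurableSet {ω | ∀ i, ‖X n ω‖ ≤ ‖X i ω‖} := fun n => by
    rw [Set.ofPred_forall]
    exact MeasurableSet.iInter fun i => measurableSet_le (hX n).norm (hX i).norm
  refine measurable_to_countable' fun n => ?_
  -- The second set accounts for the default `sInf ∅ = 0` when no point is nearest.
  have : servingIndex X ⁻¹' {n} =
      ({ω | ∀ i, ‖X n ω‖ ≤ ‖X i ω‖} ∩ ⋂ m, ⋂ (_ : m < n), {ω | ∀ i, ‖X m ω‖ ≤ ‖X i ω‖}ᶜ) ∪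
      ({_ω | n = 0} ∩ ⋂ m, {ω | ∀ i, ‖X m ω‖ ≤ ‖X i ω‖}ᶜ) := by
    ext ω
    simp only [Set.mem_preimage, Set.mem_singleton_iff, Set.mem_union, Set.mem_inter_iff,
      Set.mem_iInter, Set.mem_compl_iff]
    change sInf {n | ∀ i, ‖X n ω‖ ≤ ‖X i ω‖} = n ↔ _
    constructor
    · rintro h
      by_cases hne : {n | ∀ i, ‖X n ω‖ ≤ ‖X i ω‖}.Nonempty
      · refine Or.inl ⟨?_, fun m hm => ?_⟩
        · rw [← h]; exact Nat.sInf_mem hne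
        · rw [← h] at hm; exact Nat.notMem_of_lt_sInf hm
      · rw [Set.not_nonempty_iff_eq_empty] at hne
        refine Or.inr ⟨?_, fun m hm => ?_⟩
        · rw [hne] at h; simpa using h.symm
        · have : m ∈ {n | ∀ i, ‖X n ω‖ ≤ ‖X i ω‖} := hm
          rw [hne] at this; exact this
    · rintro (⟨h1, h2⟩ | ⟨h1, h2⟩)
      · refine le_antisymm (Nat.sInf_le h1) (not_lt.1 fun hlt => ?_)
        exact h2 _ hlt (Nat.sInf_mem (s := {n | ∀ i, ‖X n ω‖ ≤ ‖X i ω‖}) ⟨n, h1⟩)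
      · have : {n | ∀ i, ‖X n ω‖ ≤ ‖X i ω‖} = ∅ := Set.eq_empty_of_forall_notMem h2
        rw [this, h1]; simp
  rw [this]
  refine ((hS n).inter (.iInter fun m => .iInter fun _ => (hS m).compl)).union
    ((MeasurableSet.const _).inter (.iInter fun m => (hS m).compl))

lemma measurable_apply_index {f : ℕ → Ω → ℝ} (hf : ∀ i, Measurable (f i)) {N : Ω → ℕ}
    (hN : Measurable N) : Measurable fun ω => f (N ω) ω := by
  have h : Measurable fun p : ℕ × Ω => f p.1 p.2 :=
    measurable_from_prod_countable_right fun n => hf n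
  exact h.comp (hN.prodMk measurable_id)

lemma measurable_servingDistance {X : ℕ → Ω → Plane} (hX : ∀ i, Measurable (X i)) :
    Measurable (servingDistance X) := by
  have h : ∀ i, Measurable fun ω => ‖X i ω‖ := fun i => (hX i).norm
  exact measurable_apply_index h (measurable_servingIndex hX)

end Nearest

/-! ### Almost sure regularity: local finiteness, no ties, no station at the origin -/

section Regularity

variable {Ω : Type*} [MeasurableSpace Ω] {μ : Measure Ω} [IsProbabilityMeasure μ] {lam : ℝ}
  {X : ℕ → Ω → Plane}

lemma IsHomogeneousPPP.ae_locallyFinite (h : IsHomogeneousPPP μ lam X) :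
    ∀ᵐ ω ∂μ, ∀ R : ℝ, {i | ‖X i ω‖ < R}.Finite := by
  filter_upwards [ae_all_iff.2 fun n : ℕ => h.ae_count_lt_top
    (B := Metric.ball 0 n) measurableSet_ball measure_ball_lt_top] with ω hω R
  obtain ⟨n, hn⟩ := exists_nat_ge R
  refine (finite_of_pointMeasure_lt_top measurableSet_ball (hω n)).subset fun i hi => ?_
  exact mem_ball_zero_iff.2 (lt_of_lt_of_le hi hn)

lemma IsHomogeneousPPP.ae_notMem_of_null (h : IsHomogeneousPPP μ lam X) {B : Set Plane}
    (hB : MeasurableSet B) (h0 : volume B = 0) : ∀ᵐ ω ∂μ, ∀ i, X i ω ∉ B := by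
  have hm := measurable_pointMeasure h.measurable hB
  have : μ {ω | pointMeasure X ω B = (0 : ℕ)} = 1 := by
    rw [h.count_law B hB (by simp [h0]), h0, poissonMeasure_singleton]; simp
  have : ∀ᵐ ω ∂μ, pointMeasure X ω B = (0 : ℕ) :=
    (prob_compl_eq_zero_iff (hm (measurableSet_singleton _))).2 this
  filter_upwards [this] with ω hω i hi
  rw [pointMeasure_eq_count X ω hB, Nat.cast_zero, Measure.count_eq_zero_iff] at hω
  exact (hω ▸ (show i ∈ {i | X i ω ∈ B} from hi) : i ∈ (∅ : Set ℕ))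

lemma poissonMeasure_two_le (m : NNReal) :
    poissonMeasure m {n | 2 ≤ n} ≤ ENNReal.ofReal ((m : ℝ) ^ 2) := by
  have : {n : ℕ | 2 ≤ n} = ({0, 1} : Set ℕ)ᶜ := by ext n; simp; omega
  have hreal : (poissonMeasure m).real {n | 2 ≤ n} ≤ (m : ℝ) ^ 2 := by
    rw [this, probReal_compl_eq_one_sub MeasurableSet.of_discrete, Set.insert_eq,
      measureReal_union (by simp) MeasurableSet.of_discrete, poissonMeasure_real_singleton,
      poissonMeasure_real_singleton]
    simp only [pow_zero, Nat.factorial_zero, Nat.cast_one, Nat.factorial_one, pow_one, div_one,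
      mul_one]
    have h1 := Real.add_one_le_exp (-(m : ℝ))
    have h2 : (0 : ℝ) ≤ m := m.2
    -- By `exp (-m) ≥ 1 - m`, one has `1 - exp (-m) (1 + m) ≤ 1 - (1 - m) (1 + m) = m ^ 2`.
    nlinarith
  rw [← ofReal_measureReal]
  exact ENNReal.ofReal_le_ofReal hreal

lemma IsHomogeneousPPP.measure_two_le_count (h : IsHomogeneousPPP μ lam X) (hlam : 0 < lam)
    {B : Set Plane} (hB : MeasurableSet B) (hfin : volume B < ⊤) :
    μ {ω | 2 ≤ pointMeasure X ω B} ≤ ENNReal.ofReal ((lam * volume.real B) ^ 2) := by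
  have hm := measurable_pointMeasure h.measurable hB
  have hs : MeasurableSet {x : ENNReal | 2 ≤ x} := measurableSet_Ici
  have := Measure.map_apply (μ := μ) hm hs
  rw [h.map_count hB hfin, Measure.map_apply measurable_from_top hs] at this
  calc μ {ω | 2 ≤ pointMeasure X ω B} = _ := this.symm
    _ ≤ poissonMeasure (lam * (volume B).toReal).toNNReal {n | 2 ≤ n} := by
      refine measure_mono fun n hn => ?_
      have hn : (2 : ENNReal) ≤ n := hn
      exact_mod_cast hn
    _ ≤ _ := poissonMeasure_two_le _
    _ = _ := by rw [Real.coe_toNNReal _ (by positivity)]; rfl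

/-- Area is linear in the squared radius, so slices of equal width in `‖x‖ ^ 2` have equal area;
this is why the next argument slices in that variable. -/
lemma volume_annulus {a b : ℝ} (ha : 0 ≤ a) (hab : a ≤ b) :
    volume {x : Plane | a ≤ ‖x‖ ^ 2 ∧ ‖x‖ ^ 2 < b} = ENNReal.ofReal (Real.pi * (b - a)) := by
  have hb := ha.trans hab
  have hball : ∀ c : ℝ, 0 ≤ c → Metric.ball (0 : Plane) (√c) = {x | ‖x‖ ^ 2 < c} := fun c hc => by
    ext x; simp [Real.lt_sqrt (norm_nonneg x)]
  have hvol : ∀ c : ℝ, 0 ≤ c → volume {x : Plane | ‖x‖ ^ 2 < c} = ENNReal.ofReal (Real.pi * c) :=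
    fun c hc => by
    rw [← hball c hc, EuclideanSpace.volume_ball_fin_two,
      ← ENNReal.ofReal_pow (Real.sqrt_nonneg c), Real.sq_sqrt hc, ← ENNReal.ofReal_mul hc, mul_comm]
  have : {x : Plane | a ≤ ‖x‖ ^ 2 ∧ ‖x‖ ^ 2 < b} = {x | ‖x‖ ^ 2 < b} \ {x | ‖x‖ ^ 2 < a} := by
    ext x; simp [and_comm]
  have hsub : {x : Plane | ‖x‖ ^ 2 < a} ⊆ {x | ‖x‖ ^ 2 < b} := fun x hx =>
    lt_of_lt_of_le (show ‖x‖ ^ 2 < a from hx) hab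
  rw [this, measure_sdiff hsub, hvol _ hb, hvol _ ha,
    ← ENNReal.ofReal_sub _ (by positivity), mul_sub]
  · exact (measurableSet_lt (by fun_prop) measurable_const).nullMeasurableSet
  · rw [hvol _ ha]; exact ENNReal.ofReal_ne_top

/-- Cut the disc `‖x‖ ^ 2 < N` into `N n` annuli of area `π / n`. Two points of equal norm share an
annulus, and a given annulus holds two points with probability at most `(lam π / n) ^ 2`. The union
bound `N (lam π) ^ 2 / n` tends to zero. -/
lemma IsHomogeneousPPP.ae_norm_injective (h : IsHomogeneousPPP μ lam X) (hlam : 0 < lam) :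
    ∀ᵐ ω ∂μ, Function.Injective fun i => ‖X i ω‖ := by
  have key : ∀ N : ℕ, μ {ω | ∃ i j, i ≠ j ∧ ‖X i ω‖ = ‖X j ω‖ ∧ ‖X i ω‖ ^ 2 < N} = 0 := by
    intro N
    have bound : ∀ n : ℕ, 0 < n →
        μ {ω | ∃ i j, i ≠ j ∧ ‖X i ω‖ = ‖X j ω‖ ∧ ‖X i ω‖ ^ 2 < N} ≤
          ENNReal.ofReal (N * (lam * Real.pi) ^ 2 / n) := by
      intro n hn
      have hn' : (0 : ℝ) < n := by exact_mod_cast hn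
      let B : ℕ → Set Plane := fun k =>
        {x | (k : ℝ) / n ≤ ‖x‖ ^ 2 ∧ ‖x‖ ^ 2 < ((k : ℝ) + 1) / n}
      have hBvol : ∀ k, volume (B k) = ENNReal.ofReal (Real.pi / n) := fun k => by
        rw [volume_annulus (by positivity) (by gcongr; linarith)]
        congr 1; field_simp; ring
      have hsq : Measurable fun x : Plane => ‖x‖ ^ 2 := by fun_prop
      have hB : ∀ k, MeasurableSet (B k) := fun k =>
        (measurableSet_le measurable_const hsq).inter (measurableSet_lt hsq measurable_const)
      calc μ {ω | ∃ i j, i ≠ j ∧ ‖X i ω‖ = ‖X j ω‖ ∧ ‖X i ω‖ ^ 2 < N}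
          ≤ μ (⋃ k ∈ Finset.range (N * n), {ω | 2 ≤ pointMeasure X ω (B k)}) := by
            refine measure_mono ?_
            rintro ω ⟨i, j, hij, heq, hlt⟩
            have hk1 := Nat.floor_le (a := ‖X i ω‖ ^ 2 * n) (by positivity)
            have hk2 := Nat.lt_floor_add_one (‖X i ω‖ ^ 2 * n)
            have hi : X i ω ∈ B ⌊‖X i ω‖ ^ 2 * n⌋₊ :=
              ⟨by rwa [div_le_iff₀ hn'], by rwa [lt_div_iff₀ hn']⟩
            have hj : X j ω ∈ B ⌊‖X i ω‖ ^ 2 * n⌋₊ := by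
              refine ⟨?_, ?_⟩ <;> rw [← heq]
              exacts [hi.1, hi.2]
            simp only [Set.mem_iUnion, Finset.mem_range, exists_prop]
            refine ⟨⌊‖X i ω‖ ^ 2 * n⌋₊,
              (Nat.floor_lt (by positivity : 0 ≤ ‖X i ω‖ ^ 2 * n)).2 ?_, ?_⟩
            · push_cast; gcongr
            · change 2 ≤ pointMeasure X ω (B _)
              rw [pointMeasure_eq_count X ω (hB _)]
              calc (2 : ENNReal) = (({i, j} : Finset ℕ).card : ENNReal) := by
                    rw [Finset.card_pair hij]; rfl
                _ = Measure.count (({i, j} : Finset ℕ) : Set ℕ) := (Measure.count_apply_finset _).symm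
                _ ≤ _ := measure_mono fun k hk => by
                    rcases Finset.mem_insert.1 hk with rfl | hk
                    · exact hi
                    · rw [Finset.mem_singleton.1 hk]; exact hj
        _ ≤ ∑ k ∈ Finset.range (N * n), μ {ω | 2 ≤ pointMeasure X ω (B k)} :=
            measure_biUnion_finset_le _ _
        _ ≤ ∑ k ∈ Finset.range (N * n), ENNReal.ofReal ((lam * (Real.pi / n)) ^ 2) := by
            refine Finset.sum_le_sum fun k _ => ?_
            have := h.measure_two_le_count hlam (hB k) (by rw [hBvol]; exact ENNReal.ofReal_lt_top)
            rwa [measureReal_def, hBvol, ENNReal.toReal_ofReal (by positivity)] at this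
        _ = _ := by
            rw [Finset.sum_const, Finset.card_range, ← ENNReal.ofReal_nsmul]
            congr 1
            rw [nsmul_eq_mul]; push_cast; field_simp
    have lim : Tendsto (fun n : ℕ => ENNReal.ofReal (N * (lam * Real.pi) ^ 2 / n)) atTop (𝓝 0) := by
      rw [← ENNReal.ofReal_zero]
      exact (ENNReal.continuous_ofReal.tendsto _).comp (tendsto_const_div_atTop_nhds_zero_nat _)
    exact le_antisymm (ge_of_tendsto lim ((eventually_gt_atTop 0).mono bound)) zero_le
  filter_upwards [ae_all_iff.2 fun N => measure_eq_zero_iff_ae_notMem.1 (key N)] with ω hω i j hij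
  by_contra hne
  obtain ⟨N, hN⟩ := exists_nat_gt (‖X i ω‖ ^ 2)
  exact hω N ⟨i, j, hne, hij, hN⟩

lemma IsHomogeneousPPP.ae_servingDistance_lt (h : IsHomogeneousPPP μ lam X) (hlam : 0 < lam) :
    ∀ᵐ ω ∂μ, ∀ i, i ≠ servingIndex X ω → servingDistance X ω < ‖X i ω‖ := by
  filter_upwards [h.ae_locallyFinite, h.ae_norm_injective hlam] with ω hfin hinj i hi
  exact (servingDistance_le hfin i).lt_of_ne fun heq => hi (hinj heq.symm)

lemma IsHomogeneousPPP.ae_servingDistance_pos (h : IsHomogeneousPPP μ lam X) :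
    ∀ᵐ ω ∂μ, 0 < servingDistance X ω := by
  filter_upwards [h.ae_notMem_of_null (measurableSet_singleton 0) (by simp)] with ω hω
  exact norm_pos_iff.2 (hω _)

end Regularity

/-! ### The Poisson process seen beyond its nearest point -/

section ConditionalProduct

variable {Ω : Type*} [MeasurableSpace Ω] {μ : Measure Ω} [IsProbabilityMeasure μ] {lam : ℝ}
  {X : ℕ → Ω → Plane} {ψ : Plane → ℝ}

/-- The restriction of `ψ` to the points at distance more than `t` from the origin. -/
noncomputable def outside (ψ : Plane → ℝ) (t : ℝ) (x : Plane) : ℝ :=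
  {x : Plane | t < ‖x‖}.indicator ψ x

lemma measurableSet_outside (t : ℝ) : MeasurableSet {x : Plane | t < ‖x‖} :=
  measurableSet_lt measurable_const measurable_norm

lemma outside_mem_Icc (hψ : ∀ x, ψ x ∈ Set.Icc (0 : ℝ) 1) (t : ℝ) (x : Plane) :
    outside ψ t x ∈ Set.Icc (0 : ℝ) 1 := by
  unfold outside
  by_cases hx : x ∈ {x : Plane | t < ‖x‖}
  · rw [Set.indicator_of_mem hx]; exact hψ x
  · rw [Set.indicator_of_notMem hx]; simp

lemma one_sub_mem_Icc {y : ℝ} (hy : y ∈ Set.Icc (0 : ℝ) 1) : 1 - y ∈ Set.Icc (0 : ℝ) 1 :=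
  ⟨by linarith [hy.2], by linarith [hy.1]⟩

lemma measurable_outside (hm : Measurable ψ) : Measurable fun p : ℝ × Plane => outside ψ p.1 p.2 :=
  (hm.comp measurable_snd).indicator (measurableSet_lt measurable_fst measurable_snd.norm)
    (s := {p : ℝ × Plane | p.1 < ‖p.2‖})

lemma integrable_outside (hint : Integrable ψ volume) (t : ℝ) :
    Integrable (outside ψ t) volume :=
  hint.indicator (measurableSet_outside t)

/-- The probability generating functional of a Poisson process outside the disc of radius `t`. -/
noncomputable def outsideLaplace (lam : ℝ) (ψ : Plane → ℝ) (t : ℝ) : ℝ :=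
  Real.exp (-(lam * ∫ x, outside ψ t x))

lemma outsideLaplace_mem_Icc (hlam : 0 < lam) (hψ : ∀ x, ψ x ∈ Set.Icc (0 : ℝ) 1) (t : ℝ) :
    outsideLaplace lam ψ t ∈ Set.Icc (0 : ℝ) 1 :=
  exp_neg_mem_Icc (mul_nonneg hlam.le (integral_nonneg fun x => (outside_mem_Icc hψ t x).1))

lemma measurable_outsideLaplace (hm : Measurable ψ) : Measurable (outsideLaplace lam ψ) := by
  have : StronglyMeasurable fun t => ∫ x, outside ψ t x :=
    (measurable_outside hm).stronglyMeasurable.integral_prod_right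
  exact ((this.measurable.const_mul lam).neg).exp

lemma measurable_infProd_outside (hX : ∀ i, Measurable (X i)) (hm : Measurable ψ) {R : Ω → ℝ}
    (hR : Measurable R) : Measurable fun ω => infProd fun i => 1 - outside ψ (R ω) (X i ω) :=
  measurable_infProd fun i => measurable_const.sub
    ((measurable_outside hm).comp (hR.prodMk (hX i)))

lemma integrable_of_mem_Icc {f : Ω → ℝ} (hf : Measurable f)
    (h01 : ∀ ω, f ω ∈ Set.Icc (0 : ℝ) 1) : Integrable f μ :=
  (integrable_const (1 : ℝ)).mono' hf.aestronglyMeasurable (Eventually.of_forall fun ω => by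
    rw [Real.norm_of_nonneg (h01 ω).1]; exact (h01 ω).2)

lemma infProd_mem_Icc {a : ℕ → ℝ} (ha : ∀ i, a i ∈ Set.Icc (0 : ℝ) 1) :
    infProd a ∈ Set.Icc (0 : ℝ) 1 := ⟨infProd_nonneg ha, infProd_le_one ha⟩

lemma infProd_eq_zero {a : ℕ → ℝ} (ha : ∀ i, a i ∈ Set.Icc (0 : ℝ) 1) {j : ℕ} (hj : a j = 0) :
    infProd a = 0 :=
  le_antisymm ((infProd_le ha (j + 1)).trans_eq
    (Finset.prod_eq_zero (Finset.self_mem_range_succ j) hj)) (infProd_nonneg ha)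

/-- The event `u ≤ servingDistance` says that the ball `B` of radius `u` is empty, so its indicator
is the product of the factors `1 - 1_B (X i)`. As `u ≤ t`, the ball is disjoint from the region
beyond `t`. Both products therefore merge into one Laplace functional, with test function `χ`, and
additivity of the integral separates them again. -/
lemma IsHomogeneousPPP.setIntegral_le_servingDistance (h : IsHomogeneousPPP μ lam X)
    (hlam : 0 < lam) (hm : Measurable ψ) (hψ : ∀ x, ψ x ∈ Set.Icc (0 : ℝ) 1)
    (hint : Integrable ψ volume) {u t : ℝ} (hut : u ≤ t) :
    ∫ ω in {ω | u ≤ servingDistance X ω}, infProd (fun i => 1 - outside ψ t (X i ω)) ∂μ =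
      Real.exp (-(lam * volume.real (Metric.ball (0 : Plane) u))) * outsideLaplace lam ψ t := by
  let B := Metric.ball (0 : Plane) u
  let χ : Plane → ℝ := fun x => B.indicator 1 x + outside ψ t x
  have hχ : ∀ x, χ x ∈ Set.Icc (0 : ℝ) 1 := fun x => by
    by_cases hx : x ∈ B
    · have : x ∉ {x : Plane | t < ‖x‖} := fun hx' =>
        absurd (mem_ball_zero_iff.1 hx) (not_lt.2 (hut.trans (le_of_lt hx')))
      simp [χ, outside, hx, Set.indicator_of_notMem this]
    · simpa [χ, hx] using outside_mem_Icc hψ t x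
  have hBint : Integrable (B.indicator (1 : Plane → ℝ)) volume :=
    (integrable_indicator_iff measurableSet_ball).2 (integrableOn_const measure_ball_lt_top.ne)
  have hχm : Measurable χ := (measurable_one.indicator measurableSet_ball).add
    ((measurable_outside hm).comp (measurable_const.prodMk measurable_id))
  have hE : MeasurableSet {ω | u ≤ servingDistance X ω} :=
    measurableSet_le measurable_const (measurable_servingDistance h.measurable)
  have := h.integral_infProd hlam hχm hχ (hBint.add (integrable_outside hint t))
  rw [integral_add hBint (integrable_outside hint t), integral_indicator_one measurableSet_ball,
    mul_add, neg_add, Real.exp_add] at this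
  rw [outsideLaplace, ← this, ← integral_indicator hE]
  refine integral_congr_ae ?_
  filter_upwards [h.ae_locallyFinite] with ω hfin
  by_cases hω : ω ∈ {ω | u ≤ servingDistance X ω}
  · rw [Set.indicator_of_mem hω]
    congr 1; ext i
    have : X i ω ∉ B := by
      simpa [B] using (le_servingDistance_iff hfin).1 hω i
    simp [χ, this]
  · rw [Set.indicator_of_notMem hω]
    have hω' : ¬ ∀ i, u ≤ ‖X i ω‖ := fun hall => hω ((le_servingDistance_iff hfin).2 hall)
    push Not at hω'
    obtain ⟨i, hi⟩ := hω'
    refine (infProd_eq_zero (fun i => one_sub_mem_Icc (hχ _)) (j := i) ?_).symm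
    have hB : X i ω ∈ B := mem_ball_zero_iff.2 hi
    have : X i ω ∉ {x : Plane | t < ‖x‖} := fun hx' =>
        absurd hi (not_lt.2 (hut.trans (le_of_lt hx')))
    simp [χ, outside, hB, Set.indicator_of_notMem this]

/-- Subtract the previous identity at `t` from that at `u`: the factor `outsideLaplace lam ψ t` is
common to both. -/
lemma IsHomogeneousPPP.setIntegral_servingDistance_mem_Ico (h : IsHomogeneousPPP μ lam X)
    (hlam : 0 < lam) (hm : Measurable ψ) (hψ : ∀ x, ψ x ∈ Set.Icc (0 : ℝ) 1)
    (hint : Integrable ψ volume) {u t : ℝ} (hut : u ≤ t) :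
    ∫ ω in servingDistance X ⁻¹' Set.Ico u t, infProd (fun i => 1 - outside ψ t (X i ω)) ∂μ =
      ∫ _ in servingDistance X ⁻¹' Set.Ico u t, outsideLaplace lam ψ t ∂μ := by
  have hmE : ∀ u : ℝ, MeasurableSet {ω | u ≤ servingDistance X ω} := fun u =>
    measurableSet_le measurable_const (measurable_servingDistance h.measurable)
  have hset : servingDistance X ⁻¹' Set.Ico u t =
      {ω | u ≤ servingDistance X ω} \ {ω | t ≤ servingDistance X ω} := by
    ext ω; simp
  have hsub : {ω | t ≤ servingDistance X ω} ⊆ {ω | u ≤ servingDistance X ω} :=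
    fun ω hω => hut.trans hω
  -- With `ψ = 0` the previous lemma becomes the void probability of the disc.
  have hmeas : ∀ v : ℝ, v ≤ t → μ.real {ω | v ≤ servingDistance X ω} =
      Real.exp (-(lam * volume.real (Metric.ball (0 : Plane) v))) := fun v hv => by
    have := h.setIntegral_le_servingDistance hlam (ψ := 0) measurable_zero (by simp)
      (integrable_zero _ _ _) hv
    simp only [outside, outsideLaplace, Pi.zero_def, Set.indicator_zero, sub_zero, integral_zero,
      mul_zero, neg_zero, Real.exp_zero, mul_one] at this
    rw [← this, infProd]; simp
  have hI : Integrable (fun ω => infProd (fun i => 1 - outside ψ t (X i ω))) μ :=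
    integrable_of_mem_Icc (measurable_infProd_outside h.measurable hm measurable_const)
      fun ω => infProd_mem_Icc fun i => one_sub_mem_Icc (outside_mem_Icc hψ _ _)
  rw [hset, setIntegral_sdiff (hmE t) hI.integrableOn hsub,
    h.setIntegral_le_servingDistance hlam hm hψ hint hut,
    h.setIntegral_le_servingDistance hlam hm hψ hint le_rfl, setIntegral_const,
    measureReal_sdiff hsub (hmE t), hmeas u hut, hmeas t le_rfl, smul_eq_mul, sub_mul]

/-- The point of the grid `a + k / (n + 1)` that follows `r`. -/
noncomputable def gridCeil (a : ℝ) (n : ℕ) (r : ℝ) : ℝ :=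
  a + (⌊(r - a) * (n + 1)⌋₊ + 1) / (n + 1)

/-- The inequality is strict even at grid points, thanks to the `+ 1` in the definition: each value
lies in a half-open cell whose right endpoint is the exclusion radius. -/
lemma lt_gridCeil (a : ℝ) (n : ℕ) (r : ℝ) : r < gridCeil a n r := by
  have hn : (0 : ℝ) < n + 1 := by positivity
  have := Nat.lt_floor_add_one ((r - a) * (n + 1))
  rw [← lt_div_iff₀ hn] at this
  unfold gridCeil; linarith

lemma gridCeil_le {a r : ℝ} (n : ℕ) (har : a ≤ r) : gridCeil a n r ≤ r + 1 / (n + 1) := by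
  have hn : (0 : ℝ) < n + 1 := by positivity
  have := (div_le_iff₀ hn).2 (Nat.floor_le (a := (r - a) * (n + 1))
    (mul_nonneg (sub_nonneg.2 har) hn.le))
  unfold gridCeil; rw [add_div]; linarith

lemma tendsto_gridCeil {a r : ℝ} (har : a ≤ r) :
    Tendsto (fun n => gridCeil a n r) atTop (𝓝 r) := by
  have : Tendsto (fun n : ℕ => r + 1 / ((n : ℝ) + 1)) atTop (𝓝 r) := by
    simpa using tendsto_one_div_add_atTop_nhds_zero_nat.const_add r
  exact tendsto_of_tendsto_of_tendsto_of_le_of_le tendsto_const_nhds this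
    (fun n => (lt_gridCeil a n r).le) fun n => gridCeil_le n har

lemma measurable_gridCeil (a : ℝ) (n : ℕ) : Measurable (gridCeil a n) := by
  unfold gridCeil
  have : Measurable fun r : ℝ => ((⌊(r - a) * (n + 1)⌋₊ : ℕ) : ℝ) :=
    measurable_from_top.comp (Nat.measurable_floor.comp (by fun_prop))
  fun_prop

/-- The limit must be taken from above: `t ↦ outside ψ t x` jumps at `t = ‖x‖`, where it is
right-continuous. -/
lemma tendsto_outside {ψ : Plane → ℝ} {r : ℝ} {t : ℕ → ℝ} (hrt : ∀ n, r < t n)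
    (ht : Tendsto t atTop (𝓝 r)) (x : Plane) :
    Tendsto (fun n => outside ψ (t n) x) atTop (𝓝 (outside ψ r x)) := by
  by_cases hx : r < ‖x‖
  · refine tendsto_const_nhds.congr' ?_
    filter_upwards [ht.eventually (gt_mem_nhds hx)] with n hn
    simp [outside, Set.indicator, hx, hn]
  · refine tendsto_const_nhds.congr fun n => ?_
    have : ¬ t n < ‖x‖ := fun h => hx ((hrt n).trans h)
    simp [outside, Set.indicator, hx, this]

/-- The grid cells partition `[a, ∞)`, and on each of them the exclusion radius is the constant
right endpoint, so the identity for half-open intervals can be summed. -/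
lemma IsHomogeneousPPP.setIntegral_gridCeil (h : IsHomogeneousPPP μ lam X)
    (hlam : 0 < lam) (hm : Measurable ψ) (hψ : ∀ x, ψ x ∈ Set.Icc (0 : ℝ) 1)
    (hint : Integrable ψ volume) (a : ℝ) (n : ℕ) :
    ∫ ω in servingDistance X ⁻¹' Set.Ici a,
        infProd (fun i => 1 - outside ψ (gridCeil a n (servingDistance X ω)) (X i ω)) ∂μ =
      ∫ ω in servingDistance X ⁻¹' Set.Ici a,
        outsideLaplace lam ψ (gridCeil a n (servingDistance X ω)) ∂μ := by
  have hn : (0 : ℝ) < n + 1 := by positivity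
  have hR := measurable_servingDistance h.measurable
  have hg := (measurable_gridCeil a n).comp hR
  let t : ℕ → ℝ := fun k => a + k / (n + 1)
  let S : ℕ → Set Ω := fun k => servingDistance X ⁻¹' Set.Ico (t k) (t (k + 1))
  have hmem : ∀ {r : ℝ} {k : ℕ}, r ∈ Set.Ico (t k) (t (k + 1)) ↔
      a ≤ r ∧ ⌊(r - a) * (n + 1)⌋₊ = k := fun {r k} => by
    have h1 : t k ≤ r ↔ (k : ℝ) ≤ (r - a) * (n + 1) := by
      rw [← div_le_iff₀ hn]; simp only [t]; constructor <;> intro <;> linarith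
    have h2 : r < t (k + 1) ↔ (r - a) * (n + 1) < k + 1 := by
      rw [← lt_div_iff₀ hn]; simp only [t]; push_cast; constructor <;> intro <;> linarith
    rw [Set.mem_Ico, h1, h2]
    constructor
    · rintro ⟨h1, h2⟩
      have h0 : 0 ≤ (r - a) * (n + 1) := (Nat.cast_nonneg k).trans h1
      refine ⟨sub_nonneg.1 (nonneg_of_mul_nonneg_left h0 hn), (Nat.floor_eq_iff h0).2 ⟨h1, h2⟩⟩
    · rintro ⟨har, hk⟩
      exact (Nat.floor_eq_iff (mul_nonneg (sub_nonneg.2 har) hn.le)).1 hk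
  have hU : servingDistance X ⁻¹' Set.Ici a = ⋃ k, S k := by
    ext ω
    simp only [S, Set.mem_preimage, Set.mem_iUnion, hmem]
    exact ⟨fun hω => ⟨_, hω, rfl⟩, fun ⟨_, hω, _⟩ => hω⟩
  have hSm : ∀ k, MeasurableSet (S k) := fun k => hR measurableSet_Ico
  have hd : Pairwise fun k l => Disjoint (S k) (S l) := fun k l hkl =>
    Set.disjoint_left.2 fun ω h1 h2 => hkl ((hmem.1 h1).2.symm.trans (hmem.1 h2).2)
  have hval : ∀ k, ∀ ω ∈ S k, gridCeil a n (servingDistance X ω) = t (k + 1) := fun k ω hω => by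
    simp [gridCeil, (hmem.1 hω).2, t]
  rw [hU, integral_iUnion hSm hd, integral_iUnion hSm hd]
  · congr 1; ext k
    calc _ = ∫ ω in S k, infProd (fun i => 1 - outside ψ (t (k + 1)) (X i ω)) ∂μ :=
          setIntegral_congr_fun (hSm k) fun ω hω => by simp only [hval k ω hω]
      _ = ∫ ω in S k, outsideLaplace lam ψ (t (k + 1)) ∂μ := by
          refine h.setIntegral_servingDistance_mem_Ico hlam hm hψ hint ?_
          simp only [t]; gcongr; simp
      _ = _ := setIntegral_congr_fun (hSm k) fun ω hω => by simp only [hval k ω hω]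
  · exact (integrable_of_mem_Icc ((measurable_outsideLaplace hm).comp hg)
      fun ω => outsideLaplace_mem_Icc hlam hψ _).integrableOn
  · exact (integrable_of_mem_Icc (measurable_infProd_outside h.measurable hm hg)
      fun ω => infProd_mem_Icc fun i => one_sub_mem_Icc (outside_mem_Icc hψ _ _)).integrableOn

lemma tendsto_outsideLaplace (hψ : ∀ x, ψ x ∈ Set.Icc (0 : ℝ) 1)
    (hint : Integrable ψ volume) {r : ℝ} {t : ℕ → ℝ} (hrt : ∀ n, r < t n)
    (ht : Tendsto t atTop (𝓝 r)) :
    Tendsto (fun n => outsideLaplace lam ψ (t n)) atTop (𝓝 (outsideLaplace lam ψ r)) := by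
  refine (Real.continuous_exp.tendsto _).comp (Tendsto.neg (Tendsto.const_mul _ ?_))
  refine tendsto_integral_of_dominated_convergence ψ
    (fun n => (integrable_outside hint _).aestronglyMeasurable) hint
    (fun n => Eventually.of_forall fun x => ?_) (Eventually.of_forall fun x => ?_)
  · rw [Real.norm_of_nonneg (outside_mem_Icc hψ _ _).1]
    exact Set.indicator_le_self' (fun _ _ => (hψ _).1) x
  · exact tendsto_outside hrt ht x

lemma IsHomogeneousPPP.setIntegral_Ici (h : IsHomogeneousPPP μ lam X)
    (hlam : 0 < lam) (hm : Measurable ψ) (hψ : ∀ x, ψ x ∈ Set.Icc (0 : ℝ) 1)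
    (hint : Integrable ψ volume) (a : ℝ) :
    ∫ ω in servingDistance X ⁻¹' Set.Ici a,
        infProd (fun i => 1 - outside ψ (servingDistance X ω) (X i ω)) ∂μ =
      ∫ ω in servingDistance X ⁻¹' Set.Ici a, outsideLaplace lam ψ (servingDistance X ω) ∂μ := by
  have hR := measurable_servingDistance h.measurable
  have hE : MeasurableSet (servingDistance X ⁻¹' Set.Ici a) := hR measurableSet_Ici
  have h01 : ∀ t x, 1 - outside ψ t x ∈ Set.Icc (0 : ℝ) 1 := fun t x =>
    one_sub_mem_Icc (outside_mem_Icc hψ t x)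
  refine tendsto_nhds_unique (f := fun n => ∫ ω in servingDistance X ⁻¹' Set.Ici a,
    infProd (fun i => 1 - outside ψ (gridCeil a n (servingDistance X ω)) (X i ω)) ∂μ)
    (l := atTop) ?_ ?_
  · refine tendsto_integral_of_dominated_convergence (fun _ => 1)
      (fun n => (measurable_infProd_outside h.measurable hm
        ((measurable_gridCeil a n).comp hR)).aestronglyMeasurable) (integrable_const _)
      (fun n => Eventually.of_forall fun ω => ?_) ?_
    · rw [Real.norm_of_nonneg (infProd_nonneg fun i => h01 _ _)]
      exact infProd_le_one fun i => h01 _ _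
    · refine (ae_restrict_iff' hE).2 (Eventually.of_forall fun ω hω => ?_)
      refine tendsto_infProd (fun i => h01 _ _) (fun k i => h01 _ _) (fun k i => ?_) fun i => ?_
      · refine sub_le_sub_left (Set.indicator_le_indicator_of_subset (fun x hx => ?_)
          (fun x => (hψ x).1) _) 1
        exact (lt_gridCeil a k _).trans hx
      · exact (tendsto_outside (fun n => lt_gridCeil a n _) (tendsto_gridCeil hω) _).const_sub 1
  · simp_rw [h.setIntegral_gridCeil hlam hm hψ hint a]
    refine tendsto_integral_of_dominated_convergence (fun _ => 1)
      (fun n => ((measurable_outsideLaplace hm).comp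
        ((measurable_gridCeil a n).comp hR)).aestronglyMeasurable) (integrable_const _)
      (fun n => Eventually.of_forall fun ω => ?_) ?_
    · rw [Real.norm_of_nonneg (outsideLaplace_mem_Icc hlam hψ _).1]
      exact (outsideLaplace_mem_Icc hlam hψ _).2
    · refine (ae_restrict_iff' hE).2 (Eventually.of_forall fun ω hω => ?_)
      exact tendsto_outsideLaplace hψ hint (fun n => lt_gridCeil a n _) (tendsto_gridCeil hω)

/-- The two sides are the values at `E` of finite measures on the line, the images under `R` of `μ`
weighted by `Y` and by `Z`; half-lines determine such measures. -/
lemma setIntegral_preimage_eq_of_Ici {Y Z R : Ω → ℝ} (hY : Measurable Y) (hZ : Measurable Z)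
    (hR : Measurable R) (hY1 : ∀ ω, Y ω ∈ Set.Icc (0 : ℝ) 1) (hZ1 : ∀ ω, Z ω ∈ Set.Icc (0 : ℝ) 1)
    (heq : ∀ a, ∫ ω in R ⁻¹' Set.Ici a, Y ω ∂μ = ∫ ω in R ⁻¹' Set.Ici a, Z ω ∂μ)
    {E : Set ℝ} (hE : MeasurableSet E) : ∫ ω in R ⁻¹' E, Y ω ∂μ = ∫ ω in R ⁻¹' E, Z ω ∂μ := by
  let ν : (Ω → ℝ) → Measure ℝ := fun Y => (μ.withDensity fun ω => ENNReal.ofReal (Y ω)).map R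
  have hfin : ∀ Y : Ω → ℝ, Measurable Y → (∀ ω, Y ω ∈ Set.Icc (0 : ℝ) 1) →
      IsFiniteMeasure (ν Y) := fun Y hY hY1 => by
    have := isFiniteMeasure_withDensity_ofReal
      (integrable_of_mem_Icc (μ := μ) hY hY1).hasFiniteIntegral
    exact Measure.isFiniteMeasure_map _ _
  have hval : ∀ Y : Ω → ℝ, Measurable Y → (∀ ω, Y ω ∈ Set.Icc (0 : ℝ) 1) → ∀ E : Set ℝ,
      MeasurableSet E → ν Y E = ENNReal.ofReal (∫ ω in R ⁻¹' E, Y ω ∂μ) :=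
    fun Y hY hY1 E hE => by
    rw [Measure.map_apply hR hE, withDensity_apply _ (hR hE), ofReal_integral_eq_lintegral_ofReal
      (integrable_of_mem_Icc hY hY1).integrableOn (Eventually.of_forall fun ω => (hY1 ω).1)]
  have := hfin Y hY hY1
  have hν : ν Y = ν Z := Measure.ext_of_Ici _ _ fun a => by
    rw [hval Y hY hY1 _ measurableSet_Ici, hval Z hZ hZ1 _ measurableSet_Ici, heq]
  have := congrArg (fun m => m E) hν
  simp only [hval Y hY hY1 E hE, hval Z hZ hZ1 E hE] at this
  rwa [ENNReal.ofReal_eq_ofReal_iff (integral_nonneg fun ω => (hY1 ω).1)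
    (integral_nonneg fun ω => (hZ1 ω).1)] at this

/-- Given the distance `r` of the nearest point, the other points form a Poisson process outside
the disc of radius `r`. -/
lemma IsHomogeneousPPP.setIntegral_infProd_nonServing (h : IsHomogeneousPPP μ lam X)
    (hlam : 0 < lam) (hm : Measurable ψ) (hψ : ∀ x, ψ x ∈ Set.Icc (0 : ℝ) 1)
    (hint : Integrable ψ volume) {E : Set ℝ} (hE : MeasurableSet E) :
    ∫ ω in servingDistance X ⁻¹' E,
        infProd (fun i => if i = servingIndex X ω then 1 else 1 - ψ (X i ω)) ∂μ =
      ∫ ω in servingDistance X ⁻¹' E, outsideLaplace lam ψ (servingDistance X ω) ∂μ := by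
  have hR := measurable_servingDistance h.measurable
  refine Eq.trans ?_ (setIntegral_preimage_eq_of_Ici
    (measurable_infProd_outside h.measurable hm hR) ((measurable_outsideLaplace hm).comp hR) hR
    (fun ω => infProd_mem_Icc fun i => one_sub_mem_Icc (outside_mem_Icc hψ _ _))
    (fun ω => outsideLaplace_mem_Icc hlam hψ _) (h.setIntegral_Ici hlam hm hψ hint) hE)
  refine integral_congr_ae (ae_restrict_of_ae ?_)
  -- Without ties, removing the serving index is the same as restricting to norms strictly above the
  -- serving distance.
  filter_upwards [h.ae_servingDistance_lt hlam] with ω hω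
  congr 1; ext i
  split_ifs with hi
  · have : ¬ servingDistance X ω < ‖X i ω‖ := by rw [hi]; exact lt_irrefl _
    simp [outside, Set.indicator, this]
  · simp [outside, Set.indicator, hω i hi]

end ConditionalProduct

/-! ### Analytic continuation of the hypergeometric series by an Euler integral -/

section GaussContinuation

/-- `∑_{1 ≤ k ≤ m} (1 - w)⁻ᵏ`, which is `((1 - w)⁻ᵐ - 1) / w` off the origin. -/
noncomputable def invPowSum (m : ℕ) (w : ℂ) : ℂ := ∑ k ∈ Finset.range m, ((1 - w) ^ (k + 1))⁻¹

/-- The Euler integral for `₂F₁[-δ, m; 1 - δ; z]`. -/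
noncomputable def eulerIntegral (δ : ℝ) (m : ℕ) (z : ℂ) : ℂ :=
  1 - δ * z * ∫ t in Set.Ioc (0 : ℝ) 1, ((t ^ (-δ) : ℝ) : ℂ) * invPowSum m (z * t)

/-- The slit plane is star-shaped about `1`, and `1 - z t = (1 - t) · 1 + t (1 - z)`. -/
lemma one_sub_mul_mem_slitPlane {z : ℂ} (hz : 1 - z ∈ Complex.slitPlane) {t : ℝ}
    (ht : t ∈ Set.Icc (0 : ℝ) 1) : 1 - z * t ∈ Complex.slitPlane := by
  have := Complex.starConvex_one_slitPlane hz (a := 1 - t) (b := t) (by linarith [ht.2]) ht.1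
    (by ring)
  convert! this using 1
  simp only [Complex.real_smul]; push_cast; ring

lemma integrableOn_rpow_neg {δ : ℝ} (hδ : δ < 1) :
    IntegrableOn (fun t : ℝ => t ^ (-δ)) (Set.Ioc 0 1) := by
  rw [← intervalIntegrable_iff_integrableOn_Ioc_of_le zero_le_one]
  exact intervalIntegral.intervalIntegrable_rpow' (by linarith)

lemma isOpen_cutPlane : IsOpen {z : ℂ | 1 - z ∈ Complex.slitPlane} :=
  Complex.isOpen_slitPlane.preimage (continuous_const.sub continuous_id)

lemma continuousOn_invPowSum_mul (m : ℕ) : ContinuousOn (fun p : ℂ × ℝ => invPowSum m (p.1 * p.2))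
    ({z : ℂ | 1 - z ∈ Complex.slitPlane} ×ˢ Set.Icc (0 : ℝ) 1) := by
  unfold invPowSum
  refine continuousOn_finsetSum _ fun k _ => ContinuousOn.inv₀ (by fun_prop) fun p hp => ?_
  exact pow_ne_zero _ (Complex.slitPlane_ne_zero (one_sub_mul_mem_slitPlane hp.1 hp.2))

/-- Euler's integrand `t^(-δ-1) (1 - z t)^(-m)` is not integrable at `0` when `δ ≥ 0`. Subtracting
`t^(-δ-1)` and dividing by `z t` leaves `t^(-δ)` times `invPowSum m (z t)`, which is smooth up to `t
= 0`, so one can differentiate under the integral. -/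
lemma differentiableOn_eulerIntegral {δ : ℝ} (hδ : δ < 1) (m : ℕ) :
    DifferentiableOn ℂ (eulerIntegral δ m) {z : ℂ | 1 - z ∈ Complex.slitPlane} := by
  set U := {z : ℂ | 1 - z ∈ Complex.slitPlane} with hU
  intro z₀ hz₀
  refine DifferentiableAt.differentiableWithinAt ?_
  refine (differentiableAt_const _).sub (((differentiableAt_const _).mul differentiableAt_id).mul ?_)
  let g' : ℂ × ℝ → ℂ := fun p => ∑ k ∈ Finset.range m,
    ((k + 1 : ℕ) * (1 - p.1 * p.2) ^ k * p.2 / ((1 - p.1 * p.2) ^ (k + 1)) ^ 2)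
  have hne : ∀ z ∈ U, ∀ t ∈ Set.Icc (0 : ℝ) 1, ∀ k : ℕ, (1 - z * t) ^ k ≠ 0 :=
    fun z hz t ht k => pow_ne_zero _ (Complex.slitPlane_ne_zero (one_sub_mul_mem_slitPlane hz ht))
  have hg' : ContinuousOn g' (U ×ˢ Set.Icc (0 : ℝ) 1) := by
    refine continuousOn_finsetSum _ fun k _ => ContinuousOn.div (by fun_prop) (by fun_prop) ?_
    exact fun p hp => pow_ne_zero _ (hne _ hp.1 _ hp.2 _)
  -- On a closed ball times `[0, 1]` compactness bounds the regular factors; the only singularity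
  -- left, `t^(-δ)`, serves as the integrable majorant.
  obtain ⟨ε, hε, hball⟩ := Metric.nhds_basis_closedBall.mem_iff.1 (isOpen_cutPlane.mem_nhds hz₀)
  have hsub : Metric.closedBall z₀ ε ×ˢ Set.Icc (0 : ℝ) 1 ⊆ U ×ˢ Set.Icc (0 : ℝ) 1 :=
    Set.prod_mono hball subset_rfl
  obtain ⟨C, hC⟩ := ((isCompact_closedBall z₀ ε).prod isCompact_Icc).exists_bound_of_continuousOn
    (hg'.mono hsub)
  obtain ⟨C₀, hC₀⟩ := ((isCompact_closedBall z₀ ε).prod isCompact_Icc).exists_bound_of_continuousOn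
    ((continuousOn_invPowSum_mul m).mono hsub)
  have hmem : ∀ t ∈ Set.Ioc (0 : ℝ) 1, t ∈ Set.Icc (0 : ℝ) 1 := fun t ht => ⟨ht.1.le, ht.2⟩
  have hrm : AEStronglyMeasurable (fun t : ℝ => ((t ^ (-δ) : ℝ) : ℂ))
      (volume.restrict (Set.Ioc 0 1)) := by
    have : Measurable fun t : ℝ => ((t ^ (-δ) : ℝ) : ℂ) := by fun_prop
    exact this.aestronglyMeasurable
  have hslice : ∀ (f : ℂ × ℝ → ℂ), ContinuousOn f (U ×ˢ Set.Icc (0 : ℝ) 1) → ∀ z ∈ U,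
      AEStronglyMeasurable (fun t : ℝ => ((t ^ (-δ) : ℝ) : ℂ) * f (z, t))
        (volume.restrict (Set.Ioc 0 1)) := fun f hf z hz => by
    refine hrm.mul ?_
    have : ContinuousOn (fun t : ℝ => f (z, t)) (Set.Ioc 0 1) :=
      hf.comp (by fun_prop) fun t ht => ⟨hz, hmem t ht⟩
    exact this.aestronglyMeasurable measurableSet_Ioc
  have hbd : ∀ D : ℝ, Integrable (fun t : ℝ => t ^ (-δ) * D) (volume.restrict (Set.Ioc 0 1)) :=
    fun D => (integrableOn_rpow_neg hδ).mul_const D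
  refine (hasDerivAt_integral_of_dominated_loc_of_deriv_le (𝕜 := ℂ)
    (s := Metric.closedBall z₀ ε) (bound := fun t : ℝ => t ^ (-δ) * C)
    (F := fun (z : ℂ) (t : ℝ) => ((t ^ (-δ) : ℝ) : ℂ) * invPowSum m (z * t))
    (F' := fun (z : ℂ) (t : ℝ) => ((t ^ (-δ) : ℝ) : ℂ) * g' (z, t))
    (Metric.closedBall_mem_nhds z₀ hε) ?_ ?_ ?_ ?_ (hbd C) ?_).2.differentiableAt
  · filter_upwards [isOpen_cutPlane.mem_nhds hz₀] with z hz
    exact hslice (fun p => invPowSum m (p.1 * p.2)) (continuousOn_invPowSum_mul m) z hz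
  · refine (hbd C₀).mono'
      (hslice (fun p => invPowSum m (p.1 * p.2)) (continuousOn_invPowSum_mul m) z₀ hz₀) ?_
    refine (ae_restrict_iff' measurableSet_Ioc).2 (Eventually.of_forall fun t ht => ?_)
    rw [norm_mul, Complex.norm_real, Real.norm_of_nonneg (Real.rpow_nonneg ht.1.le _)]
    exact mul_le_mul_of_nonneg_left (hC₀ (z₀, t) ⟨Metric.mem_closedBall_self hε.le, hmem t ht⟩)
      (Real.rpow_nonneg ht.1.le _)
  · exact hslice g' hg' z₀ hz₀
  · refine (ae_restrict_iff' measurableSet_Ioc).2 (Eventually.of_forall fun t ht z hz => ?_)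
    rw [norm_mul, Complex.norm_real, Real.norm_of_nonneg (Real.rpow_nonneg ht.1.le _)]
    exact mul_le_mul_of_nonneg_left (hC (z, t) ⟨hz, hmem t ht⟩) (Real.rpow_nonneg ht.1.le _)
  · refine (ae_restrict_iff' measurableSet_Ioc).2 (Eventually.of_forall fun t ht z hz => ?_)
    refine HasDerivAt.const_mul _ (HasDerivAt.fun_sum fun k _ => ?_)
    have h1 : HasDerivAt (fun z : ℂ => 1 - z * t) (-(t : ℂ)) z := by
      simpa using ((hasDerivAt_id z).mul_const (t : ℂ)).const_sub 1
    convert! (h1.pow (k + 1)).inv (hne z (hball hz) t (hmem t ht) _) using 1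
    simp

lemma integral_Ioc_rpow_neg_mul_pow {δ : ℝ} (hδ : δ < 1) (n : ℕ) :
    ∫ t in Set.Ioc (0 : ℝ) 1, t ^ (-δ) * t ^ n = 1 / (n + 1 - δ) := by
  have h0 : (0 : ℝ) ≤ n := n.cast_nonneg
  calc _ = ∫ t in Set.Ioc (0 : ℝ) 1, t ^ (-δ + n) :=
        setIntegral_congr_fun measurableSet_Ioc fun t ht => by
          simp only [Real.rpow_add ht.1, Real.rpow_natCast]
    _ = _ := by
      rw [← intervalIntegral.integral_of_le zero_le_one, integral_rpow (Or.inl (by linarith)),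
        Real.one_rpow, Real.zero_rpow (by linarith)]
      congr 1 <;> ring

/-- Expand each `(1 - w)^(-(k+1))` as a binomial series; the coefficients add up by the hockey-stick
identity. -/
lemma hasSum_invPowSum (m : ℕ) {w : ℂ} (hw : ‖w‖ < 1) :
    HasSum (fun n : ℕ => ((m + 1 + n).choose (n + 1) : ℂ) * w ^ n) (invPowSum (m + 1) w) := by
  have := hasSum_sum (s := Finset.range (m + 1)) fun k _ =>
    hasSum_choose_mul_geometric_of_norm_lt_one k hw
  simp only [one_div, ← Finset.sum_mul] at this
  refine (congrArg (fun f => HasSum f _) (funext fun n => ?_)).mpr this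
  rw [add_right_comm, ← Nat.sum_range_add_choose m n]
  push_cast
  congr 1
  refine Finset.sum_congr rfl fun k _ => ?_
  rw [add_comm n k, Nat.choose_symm_add]

/-- The Pochhammer quotient collapses because `(-δ)_{n+1} = -δ (1-δ)_n` and `(1-δ)_{n+1} = (1-δ)_n
(n+1-δ)`, while `(m+1)_{n+1} / (n+1)!` is a binomial coefficient. -/
lemma hypergeometric_coeff {δ : ℝ} (hδ : δ < 1) (m n : ℕ) :
    (((n + 1).factorial : ℂ)⁻¹ * (ascPochhammer ℂ (n + 1)).eval (-δ : ℂ) *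
      (ascPochhammer ℂ (n + 1)).eval ((m + 1 : ℕ) : ℂ) *
      ((ascPochhammer ℂ (n + 1)).eval (1 - δ : ℂ))⁻¹) =
    -δ * ((m + 1 + n).choose (n + 1) / (n + 1 - δ)) := by
  have hne : ∀ k : ℕ, (1 - δ + k : ℂ) ≠ 0 := fun k h => by
    have h' : 1 - δ + k = 0 := by exact_mod_cast h
    have : (0 : ℝ) ≤ k := k.cast_nonneg
    linarith
  have h1 : (ascPochhammer ℂ (n + 1)).eval (-δ : ℂ) = -δ * (ascPochhammer ℂ n).eval (1 - δ : ℂ) := by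
    rw [ascPochhammer_succ_left, Polynomial.eval_mul, Polynomial.eval_comp]
    simp [sub_eq_neg_add]
  have h2 : (ascPochhammer ℂ (n + 1)).eval (1 - δ : ℂ) =
      (ascPochhammer ℂ n).eval (1 - δ : ℂ) * (1 - δ + n) := ascPochhammer_succ_eval _ _
  have h3 : (ascPochhammer ℂ (n + 1)).eval ((m + 1 : ℕ) : ℂ) =
      (n + 1).factorial * (m + 1 + n).choose (n + 1) := by
    rw [← ascPochhammer_eval_cast, ascPochhammer_nat_eq_ascFactorial,
      Nat.ascFactorial_eq_factorial_mul_choose]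
    push_cast; congr 2; ring_nf
  have h4 : (ascPochhammer ℂ n).eval (1 - δ : ℂ) ≠ 0 := fun h => by
    obtain ⟨k, _, hk⟩ := (ascPochhammer_eval_eq_zero_iff n _).1 h
    exact hne k (by rw [hk]; ring)
  have h5 : ((n + 1).factorial : ℂ) ≠ 0 := by exact_mod_cast (n + 1).factorial_ne_zero
  have h6 := hne n
  have h7 : (n + 1 - δ : ℂ) ≠ 0 := by convert! h6 using 1; ring
  rw [h1, h2, h3]
  field_simp
  ring

/-- Term-by-term integration: the factor `1 / (n + 1 - δ)` of the coefficient is the moment of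
`t^(-δ)` against `t^n`. -/
lemma eulerIntegral_eq_hypergeometric {δ : ℝ} (hδ : δ < 1) (m : ℕ) {z : ℂ} (hz : ‖z‖ < 1) :
    eulerIntegral δ (m + 1) z = ordinaryHypergeometric (-δ : ℂ) ((m + 1 : ℕ) : ℂ) (1 - δ : ℂ) z := by
  let c : ℕ → ℂ := fun n => ((m + 1 + n).choose (n + 1) : ℂ)
  let F : ℕ → ℝ → ℂ := fun n t => c n * z ^ n * ((t ^ (-δ) * t ^ n : ℝ) : ℂ)
  have hI : ∀ n : ℕ, Integrable (fun t : ℝ => t ^ (-δ) * t ^ n)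
      (volume.restrict (Set.Ioc (0 : ℝ) 1)) := fun n => by
    have hm : Measurable fun t : ℝ => t ^ (-δ) * t ^ n := by fun_prop
    refine (integrableOn_rpow_neg hδ).mono' hm.aestronglyMeasurable
      ((ae_restrict_iff' measurableSet_Ioc).2 (Eventually.of_forall fun t ht => ?_))
    rw [Real.norm_of_nonneg (mul_nonneg (Real.rpow_nonneg ht.1.le _) (pow_nonneg ht.1.le _))]
    exact mul_le_of_le_one_right (Real.rpow_nonneg ht.1.le _) (pow_le_one₀ ht.1.le ht.2)
  have hF : ∀ n, Integrable (F n) (volume.restrict (Set.Ioc (0 : ℝ) 1)) := fun n =>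
    (hI n).ofReal.const_mul _
  have hFn : ∀ n, ∫ t in Set.Ioc (0 : ℝ) 1, ‖F n t‖ = ‖c n * z ^ n‖ * (1 / (n + 1 - δ)) := fun n => by
    rw [← integral_Ioc_rpow_neg_mul_pow hδ n, ← integral_const_mul]
    refine setIntegral_congr_fun measurableSet_Ioc fun t ht => ?_
    simp only [F]
    rw [norm_mul, Complex.norm_real, Real.norm_of_nonneg
      (mul_nonneg (Real.rpow_nonneg ht.1.le _) (pow_nonneg ht.1.le _))]
  have hsum : Summable fun n => ∫ t in Set.Ioc (0 : ℝ) 1, ‖F n t‖ := by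
    simp_rw [hFn]
    refine Summable.of_nonneg_of_le (fun n => ?_) (fun n => ?_)
      ((hasSum_invPowSum m hz).summable.norm.mul_right (1 / (1 - δ)))
    · have : (0 : ℝ) ≤ n := n.cast_nonneg
      exact mul_nonneg (norm_nonneg _) (one_div_nonneg.2 (by linarith))
    · have : (0 : ℝ) ≤ n := n.cast_nonneg
      exact mul_le_mul_of_nonneg_left (one_div_le_one_div_of_le (by linarith) (by linarith))
        (norm_nonneg _)
  have key := hasSum_integral_of_summable_integral_norm hF hsum
  have e1 : ∫ t in Set.Ioc (0 : ℝ) 1, ∑' n, F n t =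
      ∫ t in Set.Ioc (0 : ℝ) 1, ((t ^ (-δ) : ℝ) : ℂ) * invPowSum (m + 1) (z * t) := by
    refine setIntegral_congr_fun measurableSet_Ioc fun t ht => ?_
    have hzt : ‖z * t‖ < 1 := by
      rw [norm_mul, Complex.norm_real, Real.norm_of_nonneg ht.1.le]
      exact lt_of_le_of_lt (mul_le_of_le_one_right (norm_nonneg _) ht.2) hz
    refine HasSum.tsum_eq ?_
    convert! (hasSum_invPowSum m hzt).mul_left ((t ^ (-δ) : ℝ) : ℂ) using 2 with n
    simp only [F, c]; push_cast; ring
  have e2 : ∀ n, ∫ t in Set.Ioc (0 : ℝ) 1, F n t = c n * z ^ n * (1 / (n + 1 - δ)) := fun n => by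
    simp only [F]
    rw [integral_const_mul, integral_complex_ofReal, integral_Ioc_rpow_neg_mul_pow hδ n]
    push_cast; rfl
  rw [e1] at key
  simp_rw [e2] at key
  have hz' := (key.mul_left (-δ * z))
  rw [ordinaryHypergeometric_eq_tsum, eulerIntegral]
  refine (HasSum.tsum_eq ?_).symm
  -- The zeroth term of the series is the isolated `1` in `eulerIntegral`; the integral accounts for
  -- the shifted series.
  rw [← hasSum_nat_add_iff' 1]
  have e3 : ∀ J : ℂ, 1 - δ * z * J - ∑ i ∈ Finset.range 1, (((i.factorial : ℂ)⁻¹ *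
      (ascPochhammer ℂ i).eval (-δ : ℂ) * (ascPochhammer ℂ i).eval ((m + 1 : ℕ) : ℂ) *
      ((ascPochhammer ℂ i).eval (1 - δ : ℂ))⁻¹)) • z ^ i = -δ * z * J := fun J => by simp
  rw [e3]
  refine (congrArg (fun f => HasSum f _) (funext fun n => ?_)).mpr hz'
  rw [hypergeometric_coeff hδ m n, smul_eq_mul]
  simp only [c]; ring

lemma isGaussContinuation_eulerIntegral {δ : ℝ} (hδ : δ < 1) {m : ℕ} (hm : 1 ≤ m) :
    IsGaussContinuation (-δ) m (1 - δ) (eulerIntegral δ m) := by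
  obtain ⟨m, rfl⟩ := Nat.exists_eq_add_of_le' hm
  exact ⟨(differentiableOn_eulerIntegral hδ _).analyticOnNhd isOpen_cutPlane,
    fun z hz => eulerIntegral_eq_hypergeometric hδ m hz⟩

lemma IsGaussContinuation.eqOn {a b c : ℂ} {F G : ℂ → ℂ} (hF : IsGaussContinuation a b c F)
    (hG : IsGaussContinuation a b c G) : Set.EqOn F G {z : ℂ | 1 - z ∈ Complex.slitPlane} := by
  have hconn : IsPreconnected {z : ℂ | 1 - z ∈ Complex.slitPlane} := by
    have := (Complex.starConvex_one_slitPlane.isPathConnected Complex.one_mem_slitPlane).isConnected.isPreconnected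
    convert! this.image (fun z : ℂ => 1 - z) (by fun_prop) using 1
    ext z
    exact ⟨fun h => ⟨1 - z, h, by ring⟩, by rintro ⟨w, hw, rfl⟩; simpa using hw⟩
  refine hF.1.eqOn_of_preconnected_of_eventuallyEq hG.1 hconn (z₀ := 0) (by simp) ?_
  filter_upwards [Metric.ball_mem_nhds (0 : ℂ) one_pos] with z hz
  have hz : ‖z‖ < 1 := by simpa using hz
  rw [hF.2 z hz, hG.2 z hz]

/-- By uniqueness on the connected cut plane, the continuation picked by choice is the Euler
integral. -/
lemma gaussHypergeometric_eq_re {δ : ℝ} (hδ : δ < 1) {m : ℕ} (hm : 1 ≤ m) {y : ℝ} (hy : 0 ≤ y) :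
    gaussHypergeometric (-δ) m (1 - δ) (-y) = (eulerIntegral δ m (-y)).re := by
  have hcont : IsGaussContinuation ((-δ : ℝ) : ℂ) ((m : ℝ) : ℂ) ((1 - δ : ℝ) : ℂ)
      (eulerIntegral δ m) := by
    push_cast; exact isGaussContinuation_eulerIntegral hδ hm
  have hmem : ((-y : ℝ) : ℂ) ∈ {z : ℂ | 1 - z ∈ Complex.slitPlane} := by
    refine Or.inl ?_
    simp; linarith
  have hex : ∃ F, IsGaussContinuation ((-δ : ℝ) : ℂ) ((m : ℝ) : ℂ) ((1 - δ : ℝ) : ℂ) F :=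
    ⟨_, hcont⟩
  rw [gaussHypergeometric, gaussHypergeometricC, dif_pos hex, hex.choose_spec.eqOn hcont hmem]
  push_cast; rfl

/-- `1 - (1 + u)⁻ᵐ`. -/
noncomputable def gammaLoss (m : ℕ) (u : ℝ) : ℝ := 1 - ((1 + u) ^ m)⁻¹

lemma gammaLoss_eq_mul_sum (m : ℕ) {u : ℝ} (hu : 0 ≤ u) :
    gammaLoss m u = u * ∑ k ∈ Finset.range m, ((1 + u) ^ (k + 1))⁻¹ := by
  have hne : 1 + u ≠ 0 := by positivity
  induction m with
  | zero => simp [gammaLoss]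
  | succ m ih =>
    rw [Finset.sum_range_succ, mul_add, ← ih, gammaLoss, gammaLoss]
    field_simp
    ring

/-- Euler's integral for the hypergeometric function on the negative real axis. -/
lemma gaussHypergeometric_sub_one {δ : ℝ} (hδ : δ < 1) {m : ℕ} (hm : 1 ≤ m) {y : ℝ} (hy : 0 ≤ y) :
    gaussHypergeometric (-δ) m (1 - δ) (-y) - 1 =
      ∫ t in Set.Ioc (0 : ℝ) 1, δ * t ^ (-δ - 1) * gammaLoss m (y * t) := by
  have hI : ∫ t in Set.Ioc (0 : ℝ) 1, ((t ^ (-δ) : ℝ) : ℂ) * invPowSum m (-y * t) =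
      ((∫ t in Set.Ioc (0 : ℝ) 1, t ^ (-δ) *
        ∑ k ∈ Finset.range m, ((1 + y * t) ^ (k + 1))⁻¹ : ℝ) : ℂ) := by
    rw [← integral_complex_ofReal]
    refine setIntegral_congr_fun measurableSet_Ioc fun t ht => ?_
    simp [invPowSum]
  rw [gaussHypergeometric_eq_re hδ hm hy, eulerIntegral, hI]
  have : (1 - (δ : ℂ) * -y * ((∫ t in Set.Ioc (0 : ℝ) 1, t ^ (-δ) *
        ∑ k ∈ Finset.range m, ((1 + y * t) ^ (k + 1))⁻¹ : ℝ) : ℂ)) =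
      ((1 + δ * y * ∫ t in Set.Ioc (0 : ℝ) 1, t ^ (-δ) *
        ∑ k ∈ Finset.range m, ((1 + y * t) ^ (k + 1))⁻¹ : ℝ) : ℂ) := by
    push_cast; ring
  rw [this, Complex.ofReal_re, add_sub_cancel_left, ← integral_const_mul]
  refine setIntegral_congr_fun measurableSet_Ioc fun t ht => ?_
  change δ * y * _ = _
  rw [gammaLoss_eq_mul_sum m (mul_nonneg hy ht.1.le), Real.rpow_sub_one ht.1.ne']
  have := ht.1.ne'
  field_simp

end GaussContinuation

/-! ### Beta integrals and the total loss -/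

section BetaIntegral

/-- The beta integral on the half line. -/
lemma lintegral_beta_Ioi {a c : ℝ} (ha : 0 < a) (hc : 0 < c) :
    ∫⁻ v in Set.Ioi (0 : ℝ), ENNReal.ofReal (v ^ (a - 1) * (1 / (1 + v)) ^ (a + c)) =
      ENNReal.ofReal (Real.Gamma a * Real.Gamma c / Real.Gamma (a + c)) := by
  have hG : ∀ {b r : ℝ}, 0 < b → 0 < r →
      ∫⁻ t in Set.Ioi (0 : ℝ), ENNReal.ofReal (t ^ (b - 1) * Real.exp (-(r * t))) =
        ENNReal.ofReal ((1 / r) ^ b * Real.Gamma b) := fun {b r} hb hr => by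
    have hval := Real.integral_rpow_mul_exp_neg_mul_Ioi hb hr
    have hpos : 0 < (1 / r) ^ b * Real.Gamma b :=
      mul_pos (Real.rpow_pos_of_pos (by positivity) _) (Real.Gamma_pos_of_pos hb)
    rw [← hval, ofReal_integral_eq_lintegral_ofReal]
    -- A non-integrable function would have integral `0`, whereas the closed form is positive.
    · by_contra hni
      rw [integral_undef hni] at hval
      exact hpos.ne hval
    · refine (ae_restrict_iff' measurableSet_Ioi).2 (Eventually.of_forall fun t ht => ?_)
      exact mul_nonneg (Real.rpow_nonneg (le_of_lt ht) _) (Real.exp_pos _).le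
  have hac : 0 < a + c := add_pos ha hc
  have hΓ := Real.Gamma_pos_of_pos hac
  have hmeas : Measurable fun p : ℝ × ℝ => ENNReal.ofReal
      (p.1 ^ (a - 1) * (p.2 ^ (a + c - 1) * Real.exp (-((1 + p.1) * p.2)))) := by fun_prop
  -- Tonelli: `Γ(a + c) (1 + v)^(-(a + c))` is a Gamma integral in `y`, and integrating in `v` first
  -- produces `Γ(a) Γ(c)`.
  have h1 : ∫⁻ v in Set.Ioi (0 : ℝ), ∫⁻ y in Set.Ioi (0 : ℝ), ENNReal.ofReal
      (v ^ (a - 1) * (y ^ (a + c - 1) * Real.exp (-((1 + v) * y)))) =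
      (∫⁻ v in Set.Ioi (0 : ℝ), ENNReal.ofReal (v ^ (a - 1) * (1 / (1 + v)) ^ (a + c))) *
        ENNReal.ofReal (Real.Gamma (a + c)) := by
    rw [← lintegral_mul_const' _ _ ENNReal.ofReal_ne_top]
    refine setLIntegral_congr_fun measurableSet_Ioi fun v hv => ?_
    have hv : 0 < v := hv
    have hv' : 0 ≤ v ^ (a - 1) := Real.rpow_nonneg hv.le _
    simp only [ENNReal.ofReal_mul hv']
    rw [lintegral_const_mul' _ _ ENNReal.ofReal_ne_top, hG hac (by linarith),
      ENNReal.ofReal_mul (by positivity), mul_assoc]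
  have h2 : ∫⁻ y in Set.Ioi (0 : ℝ), ∫⁻ v in Set.Ioi (0 : ℝ), ENNReal.ofReal
      (v ^ (a - 1) * (y ^ (a + c - 1) * Real.exp (-((1 + v) * y)))) =
      ENNReal.ofReal (Real.Gamma c) * ENNReal.ofReal (Real.Gamma a) := by
    have hc1 := hG (r := 1) hc one_pos
    simp only [one_mul, div_one, Real.one_rpow] at hc1
    rw [← hc1, ← lintegral_mul_const' _ _ ENNReal.ofReal_ne_top]
    refine setLIntegral_congr_fun measurableSet_Ioi fun y hy => ?_
    have hy : 0 < y := hy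
    have hnn : 0 ≤ y ^ (a + c - 1) * Real.exp (-y) := by positivity
    have : ∀ v : ℝ, v ^ (a - 1) * (y ^ (a + c - 1) * Real.exp (-((1 + v) * y))) =
        (y ^ (a + c - 1) * Real.exp (-y)) * (v ^ (a - 1) * Real.exp (-(y * v))) := fun v => by
      rw [show -((1 + v) * y) = -y + -(y * v) by ring, Real.exp_add]; ring
    simp only [this, ENNReal.ofReal_mul hnn]
    rw [lintegral_const_mul' _ _ ENNReal.ofReal_ne_top, hG ha hy, ← ENNReal.ofReal_mul hnn,
      ← ENNReal.ofReal_mul (by positivity)]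
    congr 1
    rw [one_div, Real.inv_rpow hy.le, show a + c - 1 = (c - 1) + a by ring, Real.rpow_add hy]
    have := (Real.rpow_pos_of_pos hy a).ne'
    field_simp
  rw [lintegral_lintegral_swap hmeas.aemeasurable, h2] at h1
  rw [ENNReal.ofReal_div_of_pos hΓ, ENNReal.ofReal_mul (Real.Gamma_pos_of_pos ha).le, mul_comm, h1,
    ENNReal.mul_div_cancel_right (by simpa using hΓ) ENNReal.ofReal_ne_top]

/-- The sum telescopes: for `k ≥ 1`, `Γ(k+1+δ)/Γ(k+1) - Γ(k+δ)/Γ(k) = δ Γ(k+δ)/Γ(k+1)`. -/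
lemma sum_gamma_div_gamma {δ : ℝ} (hδ : 0 < δ) (m : ℕ) :
    δ * ∑ k ∈ Finset.range (m + 1), Real.Gamma (k + δ) / Real.Gamma (k + 1) =
      Real.Gamma ((m + 1 : ℕ) + δ) / Real.Gamma (m + 1 : ℕ) := by
  induction m with
  | zero => simp [add_comm (1 : ℝ), Real.Gamma_add_one hδ.ne']
  | succ m ih =>
    have h0 : (0 : ℝ) < (m + 1 : ℕ) := by positivity
    have h1 := Real.Gamma_add_one (s := (m + 1 : ℕ) + δ) (by positivity)
    have h2 := Real.Gamma_add_one (s := (m + 1 : ℕ)) h0.ne'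
    have h3 := Real.Gamma_pos_of_pos h0
    rw [Finset.sum_range_succ, mul_add, ih, Nat.cast_succ (m + 1), add_right_comm, h1, h2]
    field_simp

/-- The loss integral `δ ∫₀^∞ v^(-δ-1) (1 - (1 + v)⁻ᵐ) dv`. -/
lemma lintegral_gammaLoss {δ : ℝ} (hδ : δ ∈ Set.Ioo (0 : ℝ) 1) {m : ℕ} (hm : 1 ≤ m) :
    ∫⁻ v in Set.Ioi (0 : ℝ), ENNReal.ofReal (δ * v ^ (-δ - 1) * gammaLoss m v) =
      ENNReal.ofReal (Real.Gamma (1 - δ) * Real.Gamma (m + δ) / Real.Gamma m) := by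
  have h1δ : 0 < 1 - δ := by linarith [hδ.2]
  have hterm : ∀ k : ℕ, 0 ≤ Real.Gamma (1 - δ) * Real.Gamma (k + δ) / Real.Gamma (k + 1) :=
    fun k => div_nonneg (mul_nonneg (Real.Gamma_pos_of_pos h1δ).le
      (Real.Gamma_pos_of_pos (add_pos_of_nonneg_of_pos k.cast_nonneg hδ.1)).le)
      (Real.Gamma_pos_of_pos (by positivity)).le
  -- Since `1 - (1 + v)^(-m) = ∑ v (1 + v)^(-(k+1))`, the `k`-th term is a beta integral with `a = 1
  -- - δ` and `c = k + δ`.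
  calc _ = ∫⁻ v in Set.Ioi (0 : ℝ), ENNReal.ofReal δ * ∑ k ∈ Finset.range m,
        ENNReal.ofReal (v ^ ((1 - δ) - 1) * (1 / (1 + v)) ^ ((1 - δ) + (k + δ))) := by
        refine setLIntegral_congr_fun measurableSet_Ioi fun v hv => ?_
        have hv : 0 < v := hv
        rw [← ENNReal.ofReal_sum_of_nonneg fun k _ => by positivity, ← ENNReal.ofReal_mul hδ.1.le]
        congr 1
        rw [gammaLoss_eq_mul_sum m hv.le, mul_assoc, ← mul_assoc (v ^ (-δ - 1)),
          Real.rpow_sub_one hv.ne', div_mul_cancel₀ _ hv.ne', Finset.mul_sum]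
        congr 1
        refine Finset.sum_congr rfl fun k _ => ?_
        rw [show 1 - δ + (k + δ) = ((k + 1 : ℕ) : ℝ) by push_cast; ring, Real.rpow_natCast,
          show 1 - δ - 1 = -δ by ring, one_div, inv_pow]
    _ = ENNReal.ofReal δ * ∑ k ∈ Finset.range m,
        ENNReal.ofReal (Real.Gamma (1 - δ) * Real.Gamma (k + δ) / Real.Gamma (k + 1)) := by
        rw [lintegral_const_mul' _ _ ENNReal.ofReal_ne_top,
          lintegral_finsetSum _ fun k _ => by fun_prop]
        congr 1
        refine Finset.sum_congr rfl fun k _ => ?_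
        rw [lintegral_beta_Ioi h1δ (add_pos_of_nonneg_of_pos k.cast_nonneg hδ.1)]
        congr 3; ring
    _ = _ := by
        rw [← ENNReal.ofReal_sum_of_nonneg fun k _ => hterm k, ← ENNReal.ofReal_mul hδ.1.le]
        congr 1
        obtain ⟨m, rfl⟩ := Nat.exists_eq_add_of_le' hm
        rw [mul_div_assoc (Real.Gamma (1 - δ)), ← sum_gamma_div_gamma hδ.1 m, mul_left_comm,
          Finset.mul_sum (Finset.range (m + 1)) _ (Real.Gamma (1 - δ))]
        simp only [mul_div_assoc]

lemma gammaLoss_mem_Icc (m : ℕ) {u : ℝ} (hu : 0 ≤ u) : gammaLoss m u ∈ Set.Icc (0 : ℝ) 1 :=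
  one_sub_mem_Icc ⟨by positivity, inv_le_one_of_one_le₀ (one_le_pow₀ (by linarith))⟩

lemma measurable_gammaLoss (m : ℕ) : Measurable (gammaLoss m) := by
  unfold gammaLoss; fun_prop

@[simp] lemma gammaLoss_zero (m : ℕ) : gammaLoss m 0 = 0 := by simp [gammaLoss]

lemma integrableOn_gammaLoss_and_integral {δ : ℝ} (hδ : δ ∈ Set.Ioo (0 : ℝ) 1) {m : ℕ}
    (hm : 1 ≤ m) :
    IntegrableOn (fun v : ℝ => δ * v ^ (-δ - 1) * gammaLoss m v) (Set.Ioi 0) ∧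
    ∫ v in Set.Ioi (0 : ℝ), δ * v ^ (-δ - 1) * gammaLoss m v =
      Real.Gamma (1 - δ) * Real.Gamma (m + δ) / Real.Gamma m := by
  have hmeas : Measurable fun v : ℝ => δ * v ^ (-δ - 1) * gammaLoss m v := by
    have := measurable_gammaLoss m; fun_prop
  have hnn : 0 ≤ᵐ[volume.restrict (Set.Ioi 0)] fun v : ℝ => δ * v ^ (-δ - 1) * gammaLoss m v := by
    refine (ae_restrict_iff' measurableSet_Ioi).2 (Eventually.of_forall fun v hv => ?_)
    exact mul_nonneg (mul_nonneg hδ.1.le (Real.rpow_nonneg (le_of_lt hv) _))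
      (gammaLoss_mem_Icc m (le_of_lt hv)).1
  have hval := lintegral_gammaLoss hδ hm
  have hm0 : (0 : ℝ) < m := by exact_mod_cast hm
  refine ⟨⟨hmeas.aestronglyMeasurable, ?_⟩, ?_⟩
  · rw [hasFiniteIntegral_iff_ofReal hnn, hval]
    exact ENNReal.ofReal_lt_top
  · rw [integral_eq_lintegral_of_nonneg_ae hnn hmeas.aestronglyMeasurable, hval,
      ENNReal.toReal_ofReal]
    exact div_nonneg (mul_nonneg (Real.Gamma_pos_of_pos (by linarith [hδ.2])).le
      (Real.Gamma_pos_of_pos (add_pos hm0 hδ.1)).le) (Real.Gamma_pos_of_pos hm0).le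

end BetaIntegral

/-! ### Polar coordinates and the path-loss variable -/

section Radial

variable {α : ℝ}

lemma rpow_neg_one_div_rpow_neg (hα : 2 < α) {v : ℝ} (hv : 0 < v) :
    (v ^ (-(1 / α))) ^ (-α) = v := by
  have : α ≠ 0 := by linarith
  rw [← Real.rpow_mul hv.le, show -(1 / α) * -α = 1 by field_simp, Real.rpow_one]

/-- For the substitution `ρ = v^(-1/α)`, that is `v = ρ^(-α)`: the area element `ρ dρ` becomes a
multiple of `v^(-2/α-1) dv`. -/
lemma radial_jacobian (hα : 2 < α) (f : ℝ → ℝ) {v : ℝ} (hv : 0 < v) :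
    v ^ (-(1 / α) - 1) * (v ^ (-(1 / α)) * f ((v ^ (-(1 / α))) ^ (-α))) =
      v ^ (-(2 / α) - 1) * f v := by
  rw [rpow_neg_one_div_rpow_neg hα hv, ← mul_assoc, ← Real.rpow_add hv]
  congr 2; ring

/-- Integration of a function of the path loss over the plane. -/
lemma integral_pathLoss (hα : 2 < α) (f : ℝ → ℝ) :
    ∫ x : Plane, f (‖x‖ ^ (-α)) =
      Real.pi * ∫ v in Set.Ioi (0 : ℝ), 2 / α * v ^ (-(2 / α) - 1) * f v := by
  have hα0 : 0 < α := by linarith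
  have hdim : Module.finrank ℝ Plane = 2 := by simp
  have hball : (volume : Measure Plane).real (Metric.ball 0 1) = Real.pi := by
    rw [measureReal_def, EuclideanSpace.volume_ball_fin_two]
    simp [Real.pi_pos.le]
  rw [integral_fun_norm_addHaar volume fun t => f (t ^ (-α)), hdim, hball,
    ← integral_comp_rpow_Ioi _ (p := -(1 / α)) (by simpa using hα0.ne')]
  simp only [nsmul_eq_mul, smul_eq_mul, Nat.add_one_sub_one, pow_one, Nat.cast_ofNat]
  rw [mul_left_comm, ← integral_const_mul]
  congr 1
  refine setIntegral_congr_fun measurableSet_Ioi fun v hv => ?_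
  rw [mul_assoc, radial_jacobian hα f hv, abs_neg, abs_of_pos (by positivity)]
  ring

lemma integrable_pathLoss (hα : 2 < α) {f : ℝ → ℝ}
    (hf : IntegrableOn (fun v : ℝ => 2 / α * v ^ (-(2 / α) - 1) * f v) (Set.Ioi 0)) :
    Integrable (fun x : Plane => f (‖x‖ ^ (-α))) := by
  have hα0 : 0 < α := by linarith
  have hdim : Module.finrank ℝ Plane = 2 := by simp
  refine (integrable_fun_norm_addHaar volume (f := fun t => f (t ^ (-α)))).2 ?_
  rw [hdim, ← integrableOn_Ioi_comp_rpow_iff' _ (p := -(1 / α)) (by simpa using hα0.ne')]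
  refine IntegrableOn.congr_fun (hf.const_mul (α / 2)) (fun v hv => ?_) measurableSet_Ioi
  simp only [Nat.add_one_sub_one, pow_one, smul_eq_mul]
  rw [radial_jacobian hα f hv]
  field_simp

lemma two_div_mem_Ioo (hα : 2 < α) : 2 / α ∈ Set.Ioo (0 : ℝ) 1 :=
  ⟨by positivity, by rw [div_lt_one (by linarith)]; exact hα⟩

lemma gammaLoss_scaled_eq (δ : ℝ) (m : ℕ) {K v : ℝ} (hK : 0 < K) (hv : 0 < v) :
    δ * v ^ (-δ - 1) * gammaLoss m (K * v) =
      K ^ (δ + 1) * (δ * (K * v) ^ (-δ - 1) * gammaLoss m (K * v)) := by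
  have : K ^ (δ + 1) * (K * v) ^ (-δ - 1) = v ^ (-δ - 1) := by
    rw [Real.mul_rpow hK.le hv.le, ← mul_assoc, ← Real.rpow_add hK]
    simp
  rw [← this]; ring

lemma integrableOn_gammaLoss_mul {δ : ℝ} (hδ : δ ∈ Set.Ioo (0 : ℝ) 1) {m : ℕ} (hm : 1 ≤ m)
    {K : ℝ} (hK : 0 ≤ K) :
    IntegrableOn (fun v : ℝ => δ * v ^ (-δ - 1) * gammaLoss m (K * v)) (Set.Ioi 0) := by
  rcases hK.eq_or_lt with rfl | hK
  · simp
  · have h := (integrableOn_gammaLoss_and_integral hδ hm).1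
    have h' := (integrableOn_Ioi_comp_mul_left_iff
      (fun v : ℝ => δ * v ^ (-δ - 1) * gammaLoss m v) 0 hK).2 (by simpa using h)
    exact IntegrableOn.congr_fun (h'.const_mul (K ^ (δ + 1)))
      (fun v hv => (gammaLoss_scaled_eq δ m hK hv).symm) measurableSet_Ioi

lemma integral_gammaLoss_mul {δ : ℝ} (hδ : δ ∈ Set.Ioo (0 : ℝ) 1) {m : ℕ} (hm : 1 ≤ m)
    {K : ℝ} (hK : 0 ≤ K) :
    ∫ v in Set.Ioi (0 : ℝ), δ * v ^ (-δ - 1) * gammaLoss m (K * v) =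
      K ^ δ * (Real.Gamma (1 - δ) * Real.Gamma (m + δ) / Real.Gamma m) := by
  rcases hK.eq_or_lt with rfl | hK
  · simp [Real.zero_rpow hδ.1.ne']
  · rw [setIntegral_congr_fun measurableSet_Ioi
      (fun v hv => gammaLoss_scaled_eq δ m hK hv), integral_const_mul,
      integral_comp_mul_left_Ioi (fun v : ℝ => δ * v ^ (-δ - 1) * gammaLoss m v) 0 hK, mul_zero,
      (integrableOn_gammaLoss_and_integral hδ hm).2, smul_eq_mul, ← mul_assoc,
      Real.rpow_add_one hK.ne', mul_inv_cancel_right₀ hK.ne']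

lemma integrable_gammaLoss_pathLoss (hα : 2 < α) {m : ℕ} (hm : 1 ≤ m) {K : ℝ} (hK : 0 ≤ K) :
    Integrable (fun x : Plane => gammaLoss m (K * ‖x‖ ^ (-α))) :=
  integrable_pathLoss hα (f := fun v => gammaLoss m (K * v))
    (integrableOn_gammaLoss_mul (two_div_mem_Ioo hα) hm hK)

lemma integral_gammaLoss_pathLoss (hα : 2 < α) {m : ℕ} (hm : 1 ≤ m) {K : ℝ} (hK : 0 ≤ K) :
    ∫ x : Plane, gammaLoss m (K * ‖x‖ ^ (-α)) = Real.pi *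
      (K ^ (2 / α) * (Real.Gamma (1 - 2 / α) * Real.Gamma (m + 2 / α) / Real.Gamma m)) := by
  rw [integral_pathLoss hα fun v => gammaLoss m (K * v),
    integral_gammaLoss_mul (two_div_mem_Ioo hα) hm hK]

lemma lt_iff_rpow_neg_lt (hα : 2 < α) {r t : ℝ} (hr : 0 < r) (ht : 0 < t) :
    r < t ↔ t ^ (-α) < r ^ (-α) :=
  (Real.rpow_lt_rpow_iff_of_neg ht hr (by linarith)).symm

/-- In the variable `v = ‖x‖^(-α)` the exterior of the disc is `v < b` with `b = r^(-α)`. Rescaling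
`v = b t` gives Euler's integral on `[0, 1]`, with prefactor `b^(-2/α) = r ^ 2`. -/
lemma integral_outside_gammaLoss_pathLoss (hα : 2 < α) {m : ℕ} (hm : 1 ≤ m) {K r : ℝ}
    (hK : 0 ≤ K) (hr : 0 < r) :
    ∫ x, outside (fun x => gammaLoss m (K * ‖x‖ ^ (-α))) r x = Real.pi * (r ^ 2 *
      (gaussHypergeometric (-(2 / α)) m (1 - 2 / α) (-K * r ^ (-α)) - 1)) := by
  have hα0 : 0 < α := by linarith
  set b := r ^ (-α) with hb
  have hb0 : 0 < b := Real.rpow_pos_of_pos hr _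
  have h1 : ∀ x : Plane, outside (fun x => gammaLoss m (K * ‖x‖ ^ (-α))) r x =
      (Set.Iio b).indicator (fun v => gammaLoss m (K * v)) (‖x‖ ^ (-α)) := fun x => by
    -- At the origin `0 ^ (-α) = 0` by convention, on the wrong side of the equivalence; harmless,
    -- because `gammaLoss m 0 = 0`.
    rcases eq_or_ne x 0 with rfl | hx
    · have : ¬ r < 0 := hr.le.not_gt
      simp [outside, Set.indicator, this, Real.zero_rpow (neg_ne_zero.2 hα0.ne')]
    · have := lt_iff_rpow_neg_lt hα hr (norm_pos_iff.2 hx)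
      simp only [outside, Set.indicator, Set.mem_Iio, Set.mem_ofPred_eq, this, hb]
  simp_rw [h1]
  rw [integral_pathLoss hα]
  congr 1
  have h2 : ∀ v : ℝ, 2 / α * v ^ (-(2 / α) - 1) *
      (Set.Iio b).indicator (fun v => gammaLoss m (K * v)) v =
      (Set.Iio b).indicator (fun v => 2 / α * v ^ (-(2 / α) - 1) * gammaLoss m (K * v)) v :=
    fun v => by
    simp only [Set.indicator]; split_ifs <;> simp
  simp_rw [h2]
  rw [setIntegral_indicator measurableSet_Iio, Set.Ioi_inter_Iio, ← integral_Ioc_eq_integral_Ioo,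
    neg_mul, gaussHypergeometric_sub_one (two_div_mem_Ioo hα).2 hm (by positivity),
    ← intervalIntegral.integral_of_le zero_le_one, ← intervalIntegral.integral_of_le hb0.le]
  have h3 := intervalIntegral.integral_comp_mul_left (a := 0) (b := 1)
    (fun v => 2 / α * v ^ (-(2 / α) - 1) * gammaLoss m (K * v)) hb0.ne'
  rw [mul_zero, mul_one, smul_eq_mul, eq_inv_mul_iff_mul_eq₀ hb0.ne',
    ← intervalIntegral.integral_const_mul] at h3
  rw [← h3, ← intervalIntegral.integral_const_mul]
  have hr2 : r ^ 2 = b ^ (-(2 / α)) := by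
    rw [hb, ← Real.rpow_mul hr.le, show -α * -(2 / α) = (2 : ℕ) by field_simp; simp,
      Real.rpow_natCast]
  rw [intervalIntegral.integral_of_le zero_le_one, intervalIntegral.integral_of_le zero_le_one]
  refine setIntegral_congr_fun measurableSet_Ioc fun t ht => ?_
  rw [Real.mul_rpow hb0.le ht.1.le, Real.rpow_sub_one hb0.ne', hr2, ← mul_assoc K]
  field_simp

end Radial

/-! ### Averaging over activity and fading -/

section Marks

/-- The positive part changes nothing almost surely, but keeps the integrand in `[0, 1]` for every
`h`, so that the product lemmas apply pointwise. -/
lemma integral_exp_neg_mul_gammaMeasure {a r u : ℝ} (ha : 0 < a) (hr : 0 < r) (hu : 0 ≤ u) :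
    ∫ h, Real.exp (-(u * max h 0)) ∂gammaMeasure a r = (r / (r + u)) ^ a := by
  have hru : 0 < r + u := by linarith
  have hΓ := (Real.Gamma_pos_of_pos ha).ne'
  rw [gammaMeasure, integral_withDensity_eq_integral_toReal_smul
    (f := gammaPDF a r) (measurable_gammaPDFReal a r).ennreal_ofReal
    (Eventually.of_forall fun _ => ENNReal.ofReal_lt_top)]
  have h1 : ∀ h : ℝ, (gammaPDF a r h).toReal • Real.exp (-(u * max h 0)) =
      (Set.Ici (0 : ℝ)).indicator (fun h => r ^ a / Real.Gamma a *
        (h ^ (a - 1) * Real.exp (-((r + u) * h)))) h := fun h => by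
    rw [gammaPDF, ENNReal.toReal_ofReal (gammaPDFReal_nonneg ha hr h), gammaPDFReal]
    by_cases hh : 0 ≤ h
    · rw [if_pos hh, Set.indicator_of_mem (Set.mem_Ici.2 hh), max_eq_left hh,
        show -((r + u) * h) = -(r * h) + -(u * h) by ring, Real.exp_add, smul_eq_mul]
      ring
    · rw [if_neg hh, Set.indicator_of_notMem (by simpa using hh), zero_smul]
  simp_rw [h1]
  rw [integral_indicator measurableSet_Ici, integral_Ici_eq_integral_Ioi, integral_const_mul,
    Real.integral_rpow_mul_exp_neg_mul_Ioi ha hru, Real.div_rpow zero_le_one hru.le,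
    Real.div_rpow hr.le hru.le, Real.one_rpow]
  field_simp

/-- The factor `exp (-u h)` contributed by a station with activity and fading `(b, h)`. -/
noncomputable def markFactor (u : ℝ) (p : Bool × ℝ) : ℝ :=
  if p.1 = true then Real.exp (-(u * max p.2 0)) else 1

lemma markFactor_mem_Icc {u : ℝ} (hu : 0 ≤ u) (p : Bool × ℝ) :
    markFactor u p ∈ Set.Icc (0 : ℝ) 1 := by
  unfold markFactor
  split_ifs
  · exact exp_neg_mem_Icc (by positivity)
  · simp

@[simp] lemma markFactor_zero (p : Bool × ℝ) : markFactor 0 p = 1 := by simp [markFactor]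

lemma measurable_markFactor : Measurable fun q : ℝ × (Bool × ℝ) => markFactor q.1 q.2 := by
  unfold markFactor
  refine Measurable.ite ?_ (by fun_prop) measurable_const
  exact (measurable_fst.comp measurable_snd) (measurableSet_singleton true)

variable {Ω : Type*} [MeasurableSpace Ω] {μ : Measure Ω} [IsProbabilityMeasure μ]
  {lam pa : ℝ} {M : ℕ} {X : ℕ → Ω → Plane} {A : ℕ → Ω → Bool} {H : ℕ → Ω → ℝ}

lemma IsTier.integral_markFactor (T : IsTier μ lam pa M X A H) (hpa : 0 ≤ pa)
    (hM : 1 ≤ M) {u : ℝ} (hu : 0 ≤ u) (i : ℕ) :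
    ∫ ω, markFactor u (A i ω, H i ω) ∂μ = 1 - pa * gammaLoss M (u / M) := by
  have hM0 : (0 : ℝ) < M := by exact_mod_cast hM
  let f : Bool → ℝ := fun b => if b = true then 1 else 0
  let g : ℝ → ℝ := fun h => 1 - Real.exp (-(u * max h 0))
  have hf : Measurable f := measurable_from_top
  have hg : Measurable g := by fun_prop
  have hfac : ∀ ω, markFactor u (A i ω, H i ω) = 1 - f (A i ω) * g (H i ω) := fun ω => by
    simp only [markFactor, f, g]; split_ifs <;> ring
  have hf01 : ∀ b, f b ∈ Set.Icc (0 : ℝ) 1 := fun b => by simp only [f]; split_ifs <;> simp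
  have hg01 : ∀ h, g h ∈ Set.Icc (0 : ℝ) 1 := fun h =>
    one_sub_mem_Icc (exp_neg_mem_Icc (by positivity))
  have hint : Integrable (fun ω => f (A i ω) * g (H i ω)) μ :=
    integrable_of_mem_Icc ((hf.comp (T.measurable_active i)).mul
      (hg.comp (T.measurable_fading i))) fun ω =>
        ⟨mul_nonneg (hf01 _).1 (hg01 _).1, mul_le_one₀ (hf01 _).2 (hg01 _).1 (hg01 _).2⟩
  have hfA : ∫ ω, f (A i ω) ∂μ = pa := by
    have : (fun ω => f (A i ω)) = {ω | A i ω = true}.indicator 1 := by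
      ext ω; by_cases h : A i ω = true <;> simp [f, h]
    have hS : MeasurableSet {ω | A i ω = true} := T.measurable_active i (measurableSet_singleton _)
    rw [this, integral_indicator_one hS, measureReal_def, T.active_law i,
      ENNReal.toReal_ofReal hpa]
  have hgH : ∫ ω, g (H i ω) ∂μ = gammaLoss M (u / M) := by
    have := isProbabilityMeasure_gammaMeasure hM0 hM0
    have he : Measurable fun h : ℝ => Real.exp (-(u * max h 0)) := by fun_prop
    rw [← integral_map (T.measurable_fading i).aemeasurable hg.aestronglyMeasurable,
      T.fading_law i, integral_sub (integrable_const _) (integrable_of_mem_Icc he fun h =>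
        exp_neg_mem_Icc (by positivity)), integral_exp_neg_mul_gammaMeasure hM0 hM0 hu,
      Real.rpow_natCast, gammaLoss, ← inv_pow, one_add_div hM0.ne', inv_div]
    simp
  simp_rw [hfac]
  rw [integral_sub (integrable_const _) hint, (T.indep_active_fading i).integral_fun_comp_mul_comp
    (T.measurable_active i).aemeasurable (T.measurable_fading i).aemeasurable
    hf.aestronglyMeasurable hg.aestronglyMeasurable, hfA, hgH]
  simp

lemma IsTier.integral_prod_markFactor (T : IsTier μ lam pa M X A H) (hpa : 0 ≤ pa)
    (hM : 1 ≤ M) {u : ℕ → ℝ} (hu : ∀ i, 0 ≤ u i) (n : ℕ) :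
    ∫ ω, ∏ i ∈ Finset.range n, markFactor (u i) (A i ω, H i ω) ∂μ =
      ∏ i ∈ Finset.range n, (1 - pa * gammaLoss M (u i / M)) := by
  have hind := T.indep_marks.precomp (g := fun i : Fin n => (i : ℕ)) Fin.val_injective
  have hm : ∀ i : ℕ, Measurable fun p : Bool × ℝ => markFactor (u i) p := fun i =>
    measurable_markFactor.comp (measurable_const.prodMk measurable_id)
  simp only [Finset.prod_range]
  rw [hind.integral_fun_prod_comp (f := fun (i : Fin n) p => markFactor (u i) p)
    (fun i => ((T.measurable_active i).prodMk (T.measurable_fading i)).aemeasurable)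
    (fun i => (hm i).aestronglyMeasurable)]
  exact Finset.prod_congr rfl fun i _ => T.integral_markFactor hpa hM (hu i) i

lemma one_sub_mul_gammaLoss_mem_Icc (hpa : pa ∈ Set.Icc (0 : ℝ) 1) {u : ℝ} (hu : 0 ≤ u) :
    1 - pa * gammaLoss M u ∈ Set.Icc (0 : ℝ) 1 :=
  one_sub_mem_Icc ⟨mul_nonneg hpa.1 (gammaLoss_mem_Icc M hu).1,
    mul_le_one₀ hpa.2 (gammaLoss_mem_Icc M hu).1 (gammaLoss_mem_Icc M hu).2⟩

lemma prod_mem_Icc {ι : Type*} {a : ι → ℝ} (ha : ∀ i, a i ∈ Set.Icc (0 : ℝ) 1) (s : Finset ι) :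
    ∏ i ∈ s, a i ∈ Set.Icc (0 : ℝ) 1 :=
  ⟨Finset.prod_nonneg fun i _ => (ha i).1, Finset.prod_le_one (fun i _ => (ha i).1)
    fun i _ => (ha i).2⟩

lemma mul_mem_Icc {x y : ℝ} (hx : x ∈ Set.Icc (0 : ℝ) 1) (hy : y ∈ Set.Icc (0 : ℝ) 1) :
    x * y ∈ Set.Icc (0 : ℝ) 1 := ⟨mul_nonneg hx.1 hy.1, mul_le_one₀ hx.2 hy.1 hy.2⟩

variable {c : ℕ → (ℕ → Plane) → ℝ} {g : (ℕ → Plane) → ℝ}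

omit [IsProbabilityMeasure μ] in
lemma IsTier.measurable_locations (T : IsTier μ lam pa M X A H) :
    Measurable fun ω i => X i ω := measurable_pi_lambda _ T.ppp.measurable

omit [IsProbabilityMeasure μ] in
lemma IsTier.measurable_marks (T : IsTier μ lam pa M X A H) :
    Measurable fun ω i => (A i ω, H i ω) :=
  measurable_pi_lambda _ fun i => (T.measurable_active i).prodMk (T.measurable_fading i)

/-- Fubini for the product law of locations and marks: with the locations frozen, the weights are
constants and the marks independent. The weight `g` makes room for an event depending on the
locations. -/
lemma IsTier.integral_mul_prod_markFactor (T : IsTier μ lam pa M X A H)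
    (hpa : pa ∈ Set.Icc (0 : ℝ) 1) (hM : 1 ≤ M) (hc : ∀ i, Measurable (c i))
    (hc0 : ∀ i x, 0 ≤ c i x) (hg : Measurable g) (hg01 : ∀ x, g x ∈ Set.Icc (0 : ℝ) 1) (n : ℕ) :
    ∫ ω, g (fun i => X i ω) *
        ∏ i ∈ Finset.range n, markFactor (c i fun i => X i ω) (A i ω, H i ω) ∂μ =
      ∫ ω, g (fun i => X i ω) *
        ∏ i ∈ Finset.range n, (1 - pa * gammaLoss M (c i (fun i => X i ω) / M)) ∂μ := by
  have hX := T.measurable_locations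
  have hY := T.measurable_marks
  let F : (ℕ → Plane) × (ℕ → Bool × ℝ) → ℝ := fun p =>
    g p.1 * ∏ i ∈ Finset.range n, markFactor (c i p.1) (p.2 i)
  have hF : Measurable F := (hg.comp measurable_fst).mul
    (Finset.measurable_prod _ fun i _ => measurable_markFactor.comp
      (((hc i).comp measurable_fst).prodMk ((measurable_pi_apply i).comp measurable_snd)))
  have hF01 : ∀ p, F p ∈ Set.Icc (0 : ℝ) 1 := fun p =>
    mul_mem_Icc (hg01 _) (prod_mem_Icc (fun i => markFactor_mem_Icc (hc0 i _) _) _)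
  have := Measure.isProbabilityMeasure_map (μ := μ) hX.aemeasurable
  have := Measure.isProbabilityMeasure_map (μ := μ) hY.aemeasurable
  have hmap := (indepFun_iff_map_prod_eq_prod_map_map hX.aemeasurable hY.aemeasurable).1
    T.indep_locations_marks
  have hrhs : Measurable fun x : ℕ → Plane => g x *
      ∏ i ∈ Finset.range n, (1 - pa * gammaLoss M (c i x / M)) :=
    hg.mul (Finset.measurable_prod _ fun i _ => measurable_const.sub
      (((measurable_gammaLoss M).comp ((hc i).div_const _)).const_mul pa))
  calc _ = ∫ p, F p ∂(μ.map fun ω => ((fun i => X i ω), fun i => (A i ω, H i ω))) :=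
        (integral_map (hX.prodMk hY).aemeasurable hF.aestronglyMeasurable).symm
    _ = ∫ x, ∫ y, F (x, y) ∂(μ.map fun ω i => (A i ω, H i ω)) ∂(μ.map fun ω i => X i ω) := by
        rw [hmap, integral_prod _ (integrable_of_mem_Icc hF hF01)]
    _ = ∫ x, g x * ∏ i ∈ Finset.range n, (1 - pa * gammaLoss M (c i x / M))
        ∂(μ.map fun ω i => X i ω) := by
        congr 1; ext x
        have hFx : Measurable fun y => F (x, y) := hF.comp (measurable_const.prodMk measurable_id)
        rw [integral_map hY.aemeasurable hFx.aestronglyMeasurable]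
        simp only [F]
        rw [integral_const_mul, T.integral_prod_markFactor hpa.1 hM fun i => hc0 i x]
    _ = _ := integral_map hX.aemeasurable hrhs.aestronglyMeasurable

/-- Averaging over activities and fading, given the locations. -/
lemma IsTier.integral_mul_infProd_markFactor (T : IsTier μ lam pa M X A H)
    (hpa : pa ∈ Set.Icc (0 : ℝ) 1) (hM : 1 ≤ M) (hc : ∀ i, Measurable (c i))
    (hc0 : ∀ i x, 0 ≤ c i x) (hg : Measurable g) (hg01 : ∀ x, g x ∈ Set.Icc (0 : ℝ) 1) :
    ∫ ω, g (fun i => X i ω) *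
        infProd (fun i => markFactor (c i fun i => X i ω) (A i ω, H i ω)) ∂μ =
      ∫ ω, g (fun i => X i ω) *
        infProd (fun i => 1 - pa * gammaLoss M (c i (fun i => X i ω) / M)) ∂μ := by
  have hX := T.measurable_locations
  have lim : ∀ a : ℕ → Ω → ℝ, (∀ i, Measurable (a i)) → (∀ i ω, a i ω ∈ Set.Icc (0 : ℝ) 1) →
      Tendsto (fun n => ∫ ω, g (fun i => X i ω) * ∏ i ∈ Finset.range n, a i ω ∂μ) atTop
        (𝓝 (∫ ω, g (fun i => X i ω) * infProd (fun i => a i ω) ∂μ)) := fun a ha ha01 => by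
    refine tendsto_integral_of_dominated_convergence (fun _ => 1) (fun n => ?_)
      (integrable_const _) (fun n => Eventually.of_forall fun ω => ?_)
      (Eventually.of_forall fun ω => (tendsto_partialProd fun i => ha01 i ω).const_mul _)
    · exact ((hg.comp hX).mul (Finset.measurable_prod _ fun i _ => ha i)).aestronglyMeasurable
    · have := mul_mem_Icc (hg01 fun i => X i ω) (prod_mem_Icc (fun i => ha01 i ω) (Finset.range n))
      rw [Real.norm_of_nonneg this.1]; exact this.2
  refine tendsto_nhds_unique (lim (fun i ω => markFactor (c i fun i => X i ω) (A i ω, H i ω))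
    (fun i => measurable_markFactor.comp (((hc i).comp hX).prodMk
      ((T.measurable_active i).prodMk (T.measurable_fading i))))
    fun i ω => markFactor_mem_Icc (hc0 i _) _) ?_
  simp_rw [T.integral_mul_prod_markFactor hpa hM hc hc0 hg hg01]
  exact lim (fun i ω => 1 - pa * gammaLoss M (c i (fun i => X i ω) / M))
    (fun i => measurable_const.sub (((measurable_gammaLoss M).comp
      (((hc i).comp hX).div_const _)).const_mul pa))
    fun i ω => one_sub_mul_gammaLoss_mem_Icc hpa (div_nonneg (hc0 i _) M.cast_nonneg)

omit [IsProbabilityMeasure μ] in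
lemma IsTier.ae_fading_nonneg (T : IsTier μ lam pa M X A H) : ∀ᵐ ω ∂μ, ∀ i, 0 ≤ H i ω := by
  refine ae_all_iff.2 fun i => ?_
  have : ∀ᵐ h ∂(μ.map (H i)), 0 ≤ h := by
    rw [T.fading_law i, ae_iff]
    have : {h : ℝ | ¬ 0 ≤ h} = Set.Iio 0 := by ext h; simp
    rw [this, gammaMeasure, withDensity_apply _ measurableSet_Iio,
      lintegral_gammaPDF_of_nonpos le_rfl]
  exact ae_of_ae_map (T.measurable_fading i).aemeasurable this

variable {P α : ℝ}

omit [MeasurableSpace Ω] in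
lemma receivedPower_nonneg (hP : 0 ≤ P) {ω : Ω} (hH : ∀ i, 0 ≤ H i ω) (i : ℕ) :
    0 ≤ receivedPower P α X A H ω i := by
  have := hH i
  unfold receivedPower; split_ifs <;> positivity

omit [MeasurableSpace Ω] in
lemma exp_neg_mul_receivedPower {ω : Ω} (hH : ∀ i, 0 ≤ H i ω) (s : ℝ) (i : ℕ) :
    Real.exp (-(s * receivedPower P α X A H ω i)) =
      markFactor (s * P * ‖X i ω‖ ^ (-α)) (A i ω, H i ω) := by
  unfold receivedPower markFactor
  simp only [max_eq_left (hH i)]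
  split_ifs
  · congr 2; ring
  · simp

/-- The loss `E[1 - exp (-s Z)]` for the power `Z` received from a station at `x`. -/
noncomputable def stationLoss (pa P α : ℝ) (M : ℕ) (s : ℝ) (x : Plane) : ℝ :=
  pa * gammaLoss M (s * P / M * ‖x‖ ^ (-α))

lemma stationLoss_mem_Icc (hpa : pa ∈ Set.Icc (0 : ℝ) 1) (hP : 0 ≤ P) {s : ℝ} (hs : 0 ≤ s)
    (x : Plane) : stationLoss pa P α M s x ∈ Set.Icc (0 : ℝ) 1 :=
  mul_mem_Icc hpa (gammaLoss_mem_Icc M (by positivity))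

lemma measurable_stationLoss (s : ℝ) : Measurable (stationLoss pa P α M s) := by
  have := measurable_gammaLoss M
  unfold stationLoss; fun_prop

lemma integrable_stationLoss (hα : 2 < α) (hM : 1 ≤ M) (hP : 0 ≤ P) {s : ℝ} (hs : 0 ≤ s) :
    Integrable (stationLoss pa P α M s) volume :=
  (integrable_gammaLoss_pathLoss hα hM (by positivity)).const_mul pa

lemma integral_stationLoss (hα : 2 < α) (hM : 1 ≤ M) (hP : 0 ≤ P) {s : ℝ} (hs : 0 ≤ s) :
    ∫ x, stationLoss pa P α M s x = pa * (Real.pi * ((s * P / M) ^ (2 / α) *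
      (Real.Gamma (1 - 2 / α) * Real.Gamma (M + 2 / α) / Real.Gamma M))) := by
  simp only [stationLoss]
  rw [integral_const_mul, integral_gammaLoss_pathLoss hα hM (by positivity)]

lemma noExclusionLaplace_eq (hα : 2 < α) (hM : 1 ≤ M) (hP : 0 ≤ P) {s : ℝ} (hs : 0 ≤ s) :
    noExclusionLaplace lam pa P α M s = Real.exp (-(lam * ∫ x, stationLoss pa P α M s x)) := by
  rw [noExclusionLaplace, integral_stationLoss hα hM hP hs]
  congr 2; ring

lemma exclusionLaplace_eq (hα : 2 < α) (hM : 1 ≤ M) (hP : 0 ≤ P) {s r : ℝ} (hs : 0 ≤ s)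
    (hr : 0 < r) :
    exclusionLaplace lam pa P α M s r = outsideLaplace lam (stationLoss pa P α M s) r := by
  have : ∀ x, outside (stationLoss pa P α M s) r x =
      pa * outside (fun x => gammaLoss M (s * P / M * ‖x‖ ^ (-α))) r x := fun x => by
    simp only [outside, Set.indicator, stationLoss]; split_ifs <;> simp
  rw [outsideLaplace, exclusionLaplace]
  simp_rw [this]
  rw [integral_const_mul, integral_outside_gammaLoss_pathLoss hα hM (by positivity) hr]
  congr 2; ring

lemma tendsto_exclusionLaplace (hα : 2 < α) (hM : 1 ≤ M) (hpa : pa ∈ Set.Icc (0 : ℝ) 1)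
    (hP : 0 ≤ P) {s : ℝ} (hs : 0 ≤ s) :
    Tendsto (fun r => exclusionLaplace lam pa P α M s r) (𝓝[>] 0)
      (𝓝 (noExclusionLaplace lam pa P α M s)) := by
  have h01 := fun x => stationLoss_mem_Icc (α := α) (M := M) hpa hP hs x
  have hint := integrable_stationLoss (pa := pa) hα hM hP hs
  have hlim : Tendsto (outsideLaplace lam (stationLoss pa P α M s)) (𝓝[>] 0)
      (𝓝 (noExclusionLaplace lam pa P α M s)) := by
    rw [noExclusionLaplace_eq hα hM hP hs]
    refine (Real.continuous_exp.tendsto _).comp (Tendsto.neg (Tendsto.const_mul _ ?_))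
    refine tendsto_integral_filter_of_dominated_convergence (stationLoss pa P α M s)
      (Eventually.of_forall fun r => (integrable_outside hint r).aestronglyMeasurable)
      (Eventually.of_forall fun r => Eventually.of_forall fun x => ?_) hint
      (Eventually.of_forall fun x => ?_)
    · rw [Real.norm_of_nonneg (outside_mem_Icc h01 _ _).1]
      exact Set.indicator_le_self' (fun _ _ => (h01 _).1) x
    -- The loss vanishes at the origin because `0 ^ (-α) = 0` by convention. Every other point is
    -- eventually outside the shrinking disc.
    · rcases eq_or_ne x 0 with rfl | hx
      · have h0 : stationLoss pa P α M s 0 = 0 := by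
          have : -α ≠ 0 := by linarith
          simp [stationLoss, Real.zero_rpow this]
        refine tendsto_const_nhds.congr fun r => ?_
        simp [outside, Set.indicator, h0]
      · refine tendsto_const_nhds.congr' ?_
        filter_upwards [mem_nhdsWithin_of_mem_nhds (gt_mem_nhds (norm_pos_iff.2 hx))] with r hr
        simp [outside, Set.indicator, hr]
  refine hlim.congr' ?_
  filter_upwards [self_mem_nhdsWithin] with r hr
  exact (exclusionLaplace_eq hα hM hP hs hr).symm

end Marks

/-! ### Convergence and Laplace transforms of the interference -/

section Interference

variable {Ω : Type*} [MeasurableSpace Ω] {μ : Measure Ω} [IsProbabilityMeasure μ]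
  {lam pa P α : ℝ} {M : ℕ} {X : ℕ → Ω → Plane} {A : ℕ → Ω → Bool} {H : ℕ → Ω → ℝ}

/-- The Laplace factor `∏ exp (-s Zᵢ)` of the total received power, as a function of the tier. -/
noncomputable def tierFactor (P α s : ℝ) (y : ℕ → Plane × Bool × ℝ) : ℝ :=
  infProd fun i => markFactor (s * P * ‖(y i).1‖ ^ (-α)) (y i).2

lemma measurable_tierFactor (P α s : ℝ) : Measurable (tierFactor P α s) := by
  refine measurable_infProd fun i => measurable_markFactor.comp (Measurable.prodMk ?_ ?_) <;>
  fun_prop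

lemma tierFactor_mem_Icc (hP : 0 ≤ P) {s : ℝ} (hs : 0 ≤ s) (y : ℕ → Plane × Bool × ℝ) :
    tierFactor P α s y ∈ Set.Icc (0 : ℝ) 1 :=
  infProd_mem_Icc fun i => markFactor_mem_Icc (by positivity) _

omit [IsProbabilityMeasure μ] in
lemma IsTier.measurable_stations (T : IsTier μ lam pa M X A H) :
    Measurable fun ω i => (X i ω, A i ω, H i ω) :=
  measurable_pi_lambda _ fun i => (T.ppp.measurable i).prodMk
    ((T.measurable_active i).prodMk (T.measurable_fading i))

lemma IsTier.integral_tierFactor (T : IsTier μ lam pa M X A H) (hlam : 0 < lam)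
    (hpa : pa ∈ Set.Icc (0 : ℝ) 1) (hP : 0 ≤ P) (hα : 2 < α) (hM : 1 ≤ M) {s : ℝ} (hs : 0 ≤ s) :
    ∫ ω, tierFactor P α s (fun i => (X i ω, A i ω, H i ω)) ∂μ =
      noExclusionLaplace lam pa P α M s := by
  have h := T.integral_mul_infProd_markFactor hpa hM (g := fun _ => 1)
    (c := fun i x => s * P * ‖x i‖ ^ (-α)) (fun i => by fun_prop) (fun i x => by positivity)
    measurable_const (fun _ => by simp)
  simp only [one_mul] at h
  have h' : ∀ x : Plane, pa * gammaLoss M (s * P * ‖x‖ ^ (-α) / M) = stationLoss pa P α M s x :=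
    fun x => by rw [stationLoss, mul_div_right_comm]
  simp only [h'] at h
  rw [noExclusionLaplace_eq hα hM hP hs, ← T.ppp.integral_infProd hlam (measurable_stationLoss s)
    (stationLoss_mem_Icc hpa hP hs) (integrable_stationLoss hα hM hP hs)]
  exact h

lemma tendsto_noExclusionLaplace (hα : 2 < α) :
    Tendsto (fun s => noExclusionLaplace lam pa P α M s) (𝓝 0) (𝓝 1) := by
  have h0 : 0 < 2 / α := (two_div_mem_Ioo hα).1
  have hc : Continuous fun s : ℝ => (s * P / M) ^ (2 / α) :=
    (Real.continuous_rpow_const h0.le).comp (by fun_prop)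
  have : Continuous fun s => noExclusionLaplace lam pa P α M s := by
    unfold noExclusionLaplace; fun_prop
  simpa [noExclusionLaplace, Real.zero_rpow h0.ne'] using this.tendsto 0

/-- Where the sum diverges, the Laplace factor is `0` for every `s > 0`. Hence the probability of
divergence is at most `1 - noExclusionLaplace` at every such `s`, and this tends to `0` with `s`. -/
lemma IsTier.ae_summable_receivedPower (T : IsTier μ lam pa M X A H) (hlam : 0 < lam)
    (hpa : pa ∈ Set.Icc (0 : ℝ) 1) (hP : 0 ≤ P) (hα : 2 < α) (hM : 1 ≤ M) :
    ∀ᵐ ω ∂μ, Summable (receivedPower P α X A H ω) := by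
  let s : ℕ → ℝ := fun n => 1 / ((n : ℝ) + 1)
  have hs : ∀ n, 0 < s n := fun n => by positivity
  let L : ℕ → Ω → ℝ := fun n ω => tierFactor P α (s n) fun i => (X i ω, A i ω, H i ω)
  have hL : ∀ n, Measurable (L n) := fun n =>
    (measurable_tierFactor P α (s n)).comp T.measurable_stations
  have hL01 : ∀ n ω, L n ω ∈ Set.Icc (0 : ℝ) 1 := fun n ω => tierFactor_mem_Icc hP (hs n).le _
  let S : Set Ω := ⋂ n, L n ⁻¹' {0}
  have hS : MeasurableSet S := .iInter fun n => hL n (measurableSet_singleton 0)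
  have hle : ∀ n, μ.real S ≤ 1 - noExclusionLaplace lam pa P α M (s n) := fun n => by
    rw [← T.integral_tierFactor hlam hpa hP hα hM (hs n).le, ← integral_indicator_one hS]
    have h1 : ∫ _, (1 : ℝ) ∂μ = 1 := by simp
    rw [← h1, ← integral_sub (integrable_const _) (integrable_of_mem_Icc (hL n) (hL01 n))]
    refine integral_mono ((integrable_const (1 : ℝ)).indicator hS)
      ((integrable_const _).sub (integrable_of_mem_Icc (hL n) (hL01 n))) fun ω => ?_
    by_cases hω : ω ∈ S
    · have : L n ω = 0 := Set.mem_iInter.1 hω n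
      simp only [Set.indicator_of_mem hω]
      change 1 ≤ 1 - L n ω
      rw [this]; simp
    · simp only [Set.indicator_of_notMem hω]
      exact sub_nonneg.2 (hL01 n ω).2
  have hlim : Tendsto (fun n => 1 - noExclusionLaplace lam pa P α M (s n)) atTop (𝓝 0) := by
    have h1 : Tendsto s atTop (𝓝 0) := tendsto_one_div_add_atTop_nhds_zero_nat
    have h2 := ((tendsto_noExclusionLaplace (lam := lam) (pa := pa) (P := P) (M := M) hα).comp
      h1).const_sub 1
    rwa [sub_self] at h2
  have hS0 : μ S = 0 := by
    rw [← measureReal_eq_zero_iff]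
    exact le_antisymm (ge_of_tendsto' hlim hle) measureReal_nonneg
  filter_upwards [T.ae_fading_nonneg, measure_eq_zero_iff_ae_notMem.1 hS0] with ω hH hω
  by_contra hns
  refine hω (Set.mem_iInter.2 fun n => ?_)
  have hns' : ¬ Summable fun i => s n * receivedPower P α X A H ω i := fun h =>
    hns ((summable_mul_left_iff (hs n).ne').1 h)
  have := infProd_exp_of_not_summable
    (fun i => mul_nonneg (hs n).le (receivedPower_nonneg hP hH i)) hns'
  simp only [exp_neg_mul_receivedPower hH] at this
  exact this

lemma IsTier.exp_otherTierInterference (T : IsTier μ lam pa M X A H) (hlam : 0 < lam)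
    (hpa : pa ∈ Set.Icc (0 : ℝ) 1) (hP : 0 ≤ P) (hα : 2 < α) (hM : 1 ≤ M) {s : ℝ} (hs : 0 ≤ s) :
    (fun ω => Real.exp (-s * otherTierInterference P α X A H ω)) =ᵐ[μ]
      fun ω => tierFactor P α s fun i => (X i ω, A i ω, H i ω) := by
  filter_upwards [T.ae_fading_nonneg, T.ae_summable_receivedPower hlam hpa hP hα hM] with ω hH hsum
  have := infProd_exp_of_summable
    (fun i => mul_nonneg hs (receivedPower_nonneg hP hH i)) (hsum.mul_left s)
  simp only [exp_neg_mul_receivedPower hH] at this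
  rw [otherTierInterference, neg_mul, ← tsum_mul_left, ← this]
  rfl

lemma IsTier.ae_summable_receivedPowerNonServing (T : IsTier μ lam pa M X A H) (hlam : 0 < lam)
    (hpa : pa ∈ Set.Icc (0 : ℝ) 1) (hP : 0 ≤ P) (hα : 2 < α) (hM : 1 ≤ M) :
    ∀ᵐ ω ∂μ, Summable (receivedPowerNonServing P α X A H ω) := by
  filter_upwards [T.ae_fading_nonneg, T.ae_summable_receivedPower hlam hpa hP hα hM] with ω hH hsum
  refine hsum.of_nonneg_of_le (fun i => ?_) fun i => ?_ <;>
  · have := receivedPower_nonneg (X := X) (A := A) (α := α) hP hH i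
    unfold receivedPowerNonServing
    split_ifs <;> simp [this]

/-- The weight of station `i` in the Laplace factor without the serving station. -/
noncomputable def nonServingWeight (P α s : ℝ) (i : ℕ) (x : ℕ → Plane) : ℝ :=
  if i = servingIndex (fun i (x : ℕ → Plane) => x i) x then 0 else s * P * ‖x i‖ ^ (-α)

lemma nonServingWeight_nonneg (hP : 0 ≤ P) {s : ℝ} (hs : 0 ≤ s) (i : ℕ) (x : ℕ → Plane) :
    0 ≤ nonServingWeight P α s i x := by
  unfold nonServingWeight; split_ifs <;> positivity

lemma measurable_nonServingWeight (P α s : ℝ) (i : ℕ) :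
    Measurable (nonServingWeight P α s i) := by
  refine Measurable.ite ?_ measurable_const (by fun_prop)
  exact measurableSet_eq_fun measurable_const
    (measurable_servingIndex fun i => measurable_pi_apply i)

/-- The Laplace factor of the received power without the serving station. -/
noncomputable def nonServingFactor (P α s : ℝ) (X : ℕ → Ω → Plane) (A : ℕ → Ω → Bool)
    (H : ℕ → Ω → ℝ) (ω : Ω) : ℝ :=
  infProd fun i => markFactor (nonServingWeight P α s i fun i => X i ω) (A i ω, H i ω)

omit [IsProbabilityMeasure μ] in
lemma IsTier.measurable_nonServingFactor (T : IsTier μ lam pa M X A H) (P α s : ℝ) :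
    Measurable (nonServingFactor P α s X A H) :=
  measurable_infProd fun i => measurable_markFactor.comp
    (((measurable_nonServingWeight P α s i).comp T.measurable_locations).prodMk
      ((T.measurable_active i).prodMk (T.measurable_fading i)))

lemma IsTier.exp_servingTierInterference (T : IsTier μ lam pa M X A H) (hlam : 0 < lam)
    (hpa : pa ∈ Set.Icc (0 : ℝ) 1) (hP : 0 ≤ P) (hα : 2 < α) (hM : 1 ≤ M) {s : ℝ} (hs : 0 ≤ s) :
    (fun ω => Real.exp (-s * servingTierInterference P α X A H ω)) =ᵐ[μ]
      nonServingFactor P α s X A H := by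
  filter_upwards [T.ae_fading_nonneg, T.ae_summable_receivedPowerNonServing hlam hpa hP hα hM]
    with ω hH hsum
  have h0 : ∀ i, 0 ≤ receivedPowerNonServing P α X A H ω i := fun i => by
    have := receivedPower_nonneg (X := X) (A := A) (α := α) hP hH i
    unfold receivedPowerNonServing
    split_ifs <;> simp [this]
  have := infProd_exp_of_summable (fun i => mul_nonneg hs (h0 i)) (hsum.mul_left s)
  rw [servingTierInterference, neg_mul, ← tsum_mul_left, ← this]
  unfold nonServingFactor nonServingWeight receivedPowerNonServing
  congr 1; ext i
  -- The serving index is a function of the locations alone: that of the coordinate process,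
  -- evaluated at the realised sequence, is definitionally `servingIndex X ω`. Its weight `0` yields
  -- the factor `1`.
  change _ = markFactor (if i = servingIndex X ω then 0 else s * P * ‖X i ω‖ ^ (-α)) _
  split_ifs
  · simp
  · exact exp_neg_mul_receivedPower hH s i

lemma IsTier.setIntegral_nonServingFactor (T : IsTier μ lam pa M X A H) (hlam : 0 < lam)
    (hpa : pa ∈ Set.Icc (0 : ℝ) 1) (hP : 0 ≤ P) (hα : 2 < α) (hM : 1 ≤ M) {s : ℝ} (hs : 0 ≤ s)
    {E : Set ℝ} (hE : MeasurableSet E) :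
    ∫ ω in servingDistance X ⁻¹' E, nonServingFactor P α s X A H ω ∂μ =
      ∫ ω in servingDistance X ⁻¹' E,
        outsideLaplace lam (stationLoss pa P α M s) (servingDistance X ω) ∂μ := by
  -- The event on the serving distance, as an indicator on the space of locations, so that it passes
  -- through the averaging over the marks.
  let g : (ℕ → Plane) → ℝ := (servingDistance (fun i (x : ℕ → Plane) => x i) ⁻¹' E).indicator 1
  have hE' := measurable_servingDistance (fun i => measurable_pi_apply (X := fun _ : ℕ => Plane) i) hE
  have hg : Measurable g := measurable_one.indicator hE'
  have hg01 : ∀ x, g x ∈ Set.Icc (0 : ℝ) 1 := fun x => by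
    simp only [g, Set.indicator]; split_ifs <;> simp
  have hset : ∀ f : Ω → ℝ, ∫ ω, g (fun i => X i ω) * f ω ∂μ =
      ∫ ω in servingDistance X ⁻¹' E, f ω ∂μ := fun f => by
    rw [← integral_indicator (measurable_servingDistance T.ppp.measurable hE)]
    congr 1; ext ω
    by_cases hω : servingDistance X ω ∈ E
    · have h1 : g (fun i => X i ω) = 1 := Set.indicator_of_mem (show _ ∈ _ ⁻¹' E from hω) 1
      rw [h1, one_mul, Set.indicator_of_mem (show ω ∈ servingDistance X ⁻¹' E from hω)]
    · have h1 : g (fun i => X i ω) = 0 := Set.indicator_of_notMem (show _ ∉ _ ⁻¹' E from hω) 1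
      rw [h1, zero_mul, Set.indicator_of_notMem (show ω ∉ servingDistance X ⁻¹' E from hω)]
  have h := T.integral_mul_infProd_markFactor hpa hM (g := g) (c := nonServingWeight P α s)
    (measurable_nonServingWeight P α s) (nonServingWeight_nonneg hP hs) hg hg01
  rw [hset, hset] at h
  rw [← T.ppp.setIntegral_infProd_nonServing hlam (measurable_stationLoss s)
    (stationLoss_mem_Icc hpa hP hs) (integrable_stationLoss hα hM hP hs) hE]
  refine Eq.trans h ?_
  congr 1; ext ω; congr 1; ext i
  change 1 - pa * gammaLoss M ((if i = servingIndex X ω then 0 else s * P * ‖X i ω‖ ^ (-α)) / M) = _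
  split_ifs
  · simp
  · rw [stationLoss, mul_div_right_comm]

lemma IsTier.condExp_exp_servingTierInterference (T : IsTier μ lam pa M X A H) (hlam : 0 < lam)
    (hpa : pa ∈ Set.Icc (0 : ℝ) 1) (hP : 0 ≤ P) (hα : 2 < α) (hM : 1 ≤ M) {s : ℝ} (hs : 0 ≤ s) :
    μ[fun ω => Real.exp (-s * servingTierInterference P α X A H ω) |
        MeasurableSpace.comap (servingDistance X) inferInstance]
      =ᵐ[μ] fun ω => exclusionLaplace lam pa P α M s (servingDistance X ω) := by
  have hR := measurable_servingDistance T.ppp.measurable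
  have hψ := measurable_outsideLaplace (lam := lam)
    (measurable_stationLoss (pa := pa) (P := P) (α := α) (M := M) s)
  have hG : Integrable (fun ω => outsideLaplace lam (stationLoss pa P α M s) (servingDistance X ω)) μ :=
    integrable_of_mem_Icc (hψ.comp hR) fun ω =>
      outsideLaplace_mem_Icc hlam (stationLoss_mem_Icc hpa hP hs) _
  have hF : Integrable (nonServingFactor P α s X A H) μ :=
    integrable_of_mem_Icc (T.measurable_nonServingFactor P α s) fun ω =>
      infProd_mem_Icc fun i => markFactor_mem_Icc (nonServingWeight_nonneg hP hs _ _) _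
  refine (condExp_congr_ae (T.exp_servingTierInterference hlam hpa hP hα hM hs)).trans ?_
  refine (ae_eq_condExp_of_forall_setIntegral_eq hR.comap_le hF
    (fun _ _ _ => hG.integrableOn) ?_ ?_).symm.trans ?_
  · rintro _ ⟨E, hE, rfl⟩ _
    exact (T.setIntegral_nonServingFactor hlam hpa hP hα hM hs hE).symm
  · exact (hψ.comp (comap_measurable _)).stronglyMeasurable.aestronglyMeasurable
  -- The hypergeometric form is only identified at positive radii; almost surely no station sits at
  -- the origin.
  · filter_upwards [T.ppp.ae_servingDistance_pos] with ω hω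
    exact (exclusionLaplace_eq hα hM hP hs hω).symm

lemma IsTier.integral_exp_otherTierInterference (T : IsTier μ lam pa M X A H) (hlam : 0 < lam)
    (hpa : pa ∈ Set.Icc (0 : ℝ) 1) (hP : 0 ≤ P) (hα : 2 < α) (hM : 1 ≤ M) {s : ℝ} (hs : 0 ≤ s) :
    ∫ ω, Real.exp (-s * otherTierInterference P α X A H ω) ∂μ =
      noExclusionLaplace lam pa P α M s := by
  rw [integral_congr_ae (T.exp_otherTierInterference hlam hpa hP hα hM hs),
    T.integral_tierFactor hlam hpa hP hα hM hs]

lemma IsTier.condExp_exp_otherTierInterference (T : IsTier μ lam pa M X A H) (hlam : 0 < lam)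
    (hpa : pa ∈ Set.Icc (0 : ℝ) 1) (hP : 0 ≤ P) (hα : 2 < α) (hM : 1 ≤ M) {s : ℝ} (hs : 0 ≤ s)
    {R : Ω → ℝ} (hR : Measurable R)
    (hind : IndepFun (fun ω i => (X i ω, A i ω, H i ω)) R μ) :
    μ[fun ω => Real.exp (-s * otherTierInterference P α X A H ω) |
        MeasurableSpace.comap R inferInstance]
      =ᵐ[μ] fun _ => noExclusionLaplace lam pa P α M s := by
  refine (condExp_congr_ae (T.exp_otherTierInterference hlam hpa hP hα hM hs)).trans ?_
  refine (condExp_indep_eq T.measurable_stations.comap_le hR.comap_le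
    ((measurable_tierFactor P α s).comp (comap_measurable _)).stronglyMeasurable
    ((IndepFun_iff_Indep _ _ _).1 hind)).trans ?_
  simp only [Function.comp_apply]
  rw [T.integral_tierFactor hlam hpa hP hα hM hs]

end Interference

theorem proposition2 {Ω : Type*} [MeasurableSpace Ω] (μ : Measure Ω) [IsProbabilityMeasure μ]
    (lam₁ lam₂ pa₁ pa₂ P₁ P₂ α₁ α₂ : ℝ) (M₁ M₂ : ℕ)
    (hlam₁ : 0 < lam₁) (hlam₂ : 0 < lam₂)
    (hpa₁ : pa₁ ∈ Set.Icc (0 : ℝ) 1) (hpa₂ : pa₂ ∈ Set.Icc (0 : ℝ) 1)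
    (hP₁ : 0 < P₁) (hP₂ : 0 < P₂) (hα₁ : 2 < α₁) (hα₂ : 2 < α₂)
    (hM₁ : 1 ≤ M₁) (hM₂ : 1 ≤ M₂)
    (X₁ X₂ : ℕ → Ω → Plane) (A₁ A₂ : ℕ → Ω → Bool) (H₁ H₂ : ℕ → Ω → ℝ)
    (tier₁ : IsTier μ lam₁ pa₁ M₁ X₁ A₁ H₁) (tier₂ : IsTier μ lam₂ pa₂ M₂ X₂ A₂ H₂)
    (indep_tiers : IndepFun (fun ω i => (X₁ i ω, A₁ i ω, H₁ i ω))
      (fun ω i => (X₂ i ω, A₂ i ω, H₂ i ω)) μ) :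
    -- the macro-tier and helper-tier interference sums converge almost surely
    (∀ᵐ ω ∂μ, Summable (receivedPowerNonServing P₁ α₁ X₁ A₁ H₁ ω)) ∧
    (∀ᵐ ω ∂μ, Summable (receivedPower P₂ α₂ X₂ A₂ H₂ ω)) ∧
    ∀ s : ℝ, 0 ≤ s →
      -- macro tier: conditional Laplace transform given the serving distance `r`
      (μ[fun ω => Real.exp (-s * servingTierInterference P₁ α₁ X₁ A₁ H₁ ω) |
          MeasurableSpace.comap (servingDistance X₁) inferInstance]
        =ᵐ[μ] fun ω => exclusionLaplace lam₁ pa₁ P₁ α₁ M₁ s (servingDistance X₁ ω)) ∧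
      -- helper tier: conditional Laplace transform given the serving distance
      (μ[fun ω => Real.exp (-s * otherTierInterference P₂ α₂ X₂ A₂ H₂ ω) |
          MeasurableSpace.comap (servingDistance X₁) inferInstance]
        =ᵐ[μ] fun _ => noExclusionLaplace lam₂ pa₂ P₂ α₂ M₂ s) ∧
      -- helper tier: unconditional Laplace transform
      ∫ ω, Real.exp (-s * otherTierInterference P₂ α₂ X₂ A₂ H₂ ω) ∂μ
        = noExclusionLaplace lam₂ pa₂ P₂ α₂ M₂ s ∧
      -- the helper-tier expression is the limit of vanishing exclusion radius
      Tendsto (fun r₀ : ℝ => exclusionLaplace lam₂ pa₂ P₂ α₂ M₂ s r₀) (𝓝[>] 0)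
        (𝓝 (noExclusionLaplace lam₂ pa₂ P₂ α₂ M₂ s)) := by
  -- The serving distance is a measurable function of the macro tier, so it inherits independence
  -- from the helper tier.
  have hR : Measurable fun y : ℕ → Plane × Bool × ℝ =>
      servingDistance (fun i (y : ℕ → Plane × Bool × ℝ) => (y i).1) y :=
    measurable_servingDistance fun i => measurable_fst.comp (measurable_pi_apply i)
  have hind : IndepFun (fun ω i => (X₂ i ω, A₂ i ω, H₂ i ω)) (servingDistance X₁) μ :=
    indep_tiers.symm.comp measurable_id hR
  refine ⟨tier₁.ae_summable_receivedPowerNonServing hlam₁ hpa₁ hP₁.le hα₁ hM₁,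
    tier₂.ae_summable_receivedPower hlam₂ hpa₂ hP₂.le hα₂ hM₂, fun s hs => ⟨?_, ?_, ?_, ?_⟩⟩
  · exact tier₁.condExp_exp_servingTierInterference hlam₁ hpa₁ hP₁.le hα₁ hM₁ hs
  · exact tier₂.condExp_exp_otherTierInterference hlam₂ hpa₂ hP₂.le hα₂ hM₂ hs
      (measurable_servingDistance tier₁.ppp.measurable) hind
  · exact tier₂.integral_exp_otherTierInterference hlam₂ hpa₂ hP₂.le hα₂ hM₂ hs
  · exact tendsto_exclusionLaplace hα₂ hM₂ hpa₂ hP₂.le hs
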